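/- Let $\pi: M\to N$ be a smooth fibre bundle (with finite-dimensional smooth Hausdorff manifolds without boundary as total space, base and typical fibre). Write $\tau: TM\to M$ for the tangent bundle and $\mathring TM$, $\mathring TN$ for $TM$, $TN$ with the zero section removed. Let $F: TM\to\mathbb R$ be a Finsler function: $F$ is continuous and non-negative, $F(\lambda u)=\lambda F(u)$ for $\lambda>0$, $F$ is smooth on $\mathring TM$, and the energy $E=\frac12F^2$ has a positive definite Hessian $\big(\partial^2E/\partial u^a\partial u^b\big)$ along the fibres at every point of $\mathring TM$, where $(q^a,u^a)$ are natural coordinates on $TM$. For a vector field $X=X^a\,\partial/\partial q^a$ on $M$ let $X^{v}=X^a\,\partial/\partial u^a$ and $X^{c}=X^a\,\partial/\partial q^a+u^a\,(\partial X^b/\partial q^a)\,\partial/\partial u^b$ be its vertical and complete lifts to $TM$, and let $\Delta=u^a\,\partial/\partial u^a$. A spray is a smooth second-order vector field $S=u^a\,\partial/\partial q^a+f^a\,\partial/\partial u^a$ on $\mathring TM$ with $[\Delta,S]=S$. The canonical spray of $F$ is the spray $S$ on $\mathring TM$ with $S(X^{v}(E))-X^{c}(E)=0$ for every smooth vector field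 $X$ on $M$. A spray $\tilde S$ is projectively related to $S$ if $\tilde S=S-2P\Delta$ for some positively $1$-homogeneous function $P$. A nonlinear splitting on $\pi$ is a map $h:\pi^*TN\to TM$, smooth on the slit pullback bundle $\pi^*\mathring TN$, such that $\tau(h(m,v))=m$ and $T\pi(h(m,v))=v$ for all $(m,v)\in\pi^*TN$. The nonlinear splitting induced by $F$ is the map $h:\pi^*TN\to TM$ with $\tau(h(m,v))=m$, $T\pi(h(m,v))=v$ and $Y^{v}(E)\circ h=0$ for every smooth $\pi$-vertical vector field $Y$ on $M$. A vector field on $\mathring TM$ is tangent to $\operatorname{Im}h$ if at every point $h(m,v)$ with $v\neq0$ its value lies in the tangent space of the submanifold $h(\pi^*\mathring TN)$, that is, in the range of $T_{(m,v)}h$. Then: (i) There is exactly one map $h$ satisfying the conditions that define the splitting induced by $F$; it is a nonlinear splitting, and it is positively homogeneous of degree $1$: $h(m,\lambda v)=\lambda\,h(m,v)$ for all $\lambda>0$ and $(m,v)\in\pi^*TN$. (ii) The canonical spray $S$ of $F$ is tangent to $\operatorname{Im}h$ if and only if $Y^{c}(E)\circ h=0$ for every smooth $\pi$-vertical vector field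 $Y$ on $M$. (iii) If the canonical spray $S$ is tangent to $\operatorname{Im}h$, then so is every spray projectively related to $S$. -/

import Mathlib

open Bundle Set
open scoped Manifold ContDiff

noncomputable section

namespace FinslerSplitting

section Tangent

variable {E : Type*} [NormedAddCommGroup E] [NormedSpace ℝ E]
  {M : Type*} [TopologicalSpace M] [ChartedSpace E M] [IsManifold 𝓘(ℝ, E) ∞ M]

/-- The slit tangent bundle: the tangent bundle with its zero section removed. -/
def slit (E M : Type*) [NormedAddCommGroup E] [NormedSpace ℝ E]
    [TopologicalSpace M] [ChartedSpace E M] [IsManifold 𝓘(ℝ, E) ∞ M] :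
    Set (TangentBundle 𝓘(ℝ, E) M) :=
  {u | u.2 ≠ 0}

/-- Fibrewise multiplication of a tangent vector by a real number. -/
def scale (c : ℝ) (u : TangentBundle 𝓘(ℝ, E) M) : TangentBundle 𝓘(ℝ, E) M :=
  ⟨u.1, c • u.2⟩

/-- The vector `a ∂/∂q + b ∂/∂u` at the point `u` of `TM`, where `(q, u)` are the natural
coordinates on `TM` that come from the preferred chart of `M` at the base point of `u`: the image
of `(a, b)` under the derivative of the inverse of the natural chart. -/
def natVec (u : TangentBundle 𝓘(ℝ, E) M) (a b : E) : TangentSpace 𝓘(ℝ, E).tangent u :=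
  mfderiv 𝓘(ℝ, E × E) 𝓘(ℝ, E).tangent (extChartAt 𝓘(ℝ, E).tangent u).symm
    (extChartAt 𝓘(ℝ, E).tangent u u) (a, b)

/-- The components, in the preferred chart at the point `m`, of a vector field `X` on `M`, as a
function of the coordinates. -/
def comps (m : M) (X : (m : M) → TangentSpace 𝓘(ℝ, E) m) (x : E) : E :=
  mfderiv 𝓘(ℝ, E) 𝓘(ℝ, E) (extChartAt 𝓘(ℝ, E) m) ((extChartAt 𝓘(ℝ, E) m).symm x)
    (X ((extChartAt 𝓘(ℝ, E) m).symm x))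

/-- The fibre coordinates of a tangent vector in the preferred chart at its base point. -/
def fibreCoord (u : TangentBundle 𝓘(ℝ, E) M) : E :=
  mfderiv 𝓘(ℝ, E) 𝓘(ℝ, E) (extChartAt 𝓘(ℝ, E) u.1) u.1 u.2

/-- Smooth vector fields on `M`. -/
def IsSmoothVF (X : (m : M) → TangentSpace 𝓘(ℝ, E) m) : Prop :=
  ContMDiff 𝓘(ℝ, E) 𝓘(ℝ, E).tangent ∞ (fun m => (⟨m, X m⟩ : TangentBundle 𝓘(ℝ, E) M))

/-- The vertical lift `Xᵃ ∂/∂uᵃ` of a vector field. -/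
def vLift (X : (m : M) → TangentSpace 𝓘(ℝ, E) m) (u : TangentBundle 𝓘(ℝ, E) M) :
    TangentSpace 𝓘(ℝ, E).tangent u :=
  natVec u 0 (comps u.1 X (extChartAt 𝓘(ℝ, E) u.1 u.1))

/-- The complete lift `Xᵃ ∂/∂qᵃ + uᵃ (∂Xᵇ/∂qᵃ) ∂/∂uᵇ` of a vector field. -/
def cLift (X : (m : M) → TangentSpace 𝓘(ℝ, E) m) (u : TangentBundle 𝓘(ℝ, E) M) :
    TangentSpace 𝓘(ℝ, E).tangent u :=
  natVec u (comps u.1 X (extChartAt 𝓘(ℝ, E) u.1 u.1))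
    (fderiv ℝ (comps u.1 X) (extChartAt 𝓘(ℝ, E) u.1 u.1) (fibreCoord u))

/-- The Liouville vector field `Δ = uᵃ ∂/∂uᵃ` on `TM`. -/
def liouville (u : TangentBundle 𝓘(ℝ, E) M) : TangentSpace 𝓘(ℝ, E).tangent u :=
  natVec u 0 (fibreCoord u)

/-- The derivative `V(f)` of a function `f` on `TM` along a vector field `V` on `TM`. -/
def act (V : (u : TangentBundle 𝓘(ℝ, E) M) → TangentSpace 𝓘(ℝ, E).tangent u)
    (f : TangentBundle 𝓘(ℝ, E) M → ℝ) (u : TangentBundle 𝓘(ℝ, E) M) : ℝ :=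
  mfderiv 𝓘(ℝ, E).tangent 𝓘(ℝ, ℝ) f u (V u)

/-- The energy `F² / 2`. -/
def energy (F : TangentBundle 𝓘(ℝ, E) M → ℝ) (u : TangentBundle 𝓘(ℝ, E) M) : ℝ :=
  F u ^ 2 / 2

/-- Finsler functions. In the last field, the second derivative at `0` of `t ↦ E(u + t w)` is the
value `wᵃ wᵇ ∂²E/∂uᵃ∂uᵇ` at `u` of the Hessian form along the fibre. -/
structure IsFinsler (F : TangentBundle 𝓘(ℝ, E) M → ℝ) : Prop where
  nonneg : ∀ u, 0 ≤ F u
  continuous : Continuous F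
  homogeneous : ∀ (c : ℝ) (u : TangentBundle 𝓘(ℝ, E) M), 0 < c → F (scale c u) = c * F u
  smooth : ContMDiffOn 𝓘(ℝ, E).tangent 𝓘(ℝ, ℝ) ∞ F (slit E M)
  strongly_convex : ∀ (m : M) (u w : TangentSpace 𝓘(ℝ, E) m), u ≠ 0 → w ≠ 0 →
    0 < deriv (deriv fun t : ℝ => energy F (⟨m, u + t • w⟩ : TangentBundle 𝓘(ℝ, E) M)) 0

/-- Sprays: smooth second-order vector fields `S` on the slit tangent bundle with `[Δ, S] = S`.
Values on the zero section play no role. -/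
structure IsSpray (S : (u : TangentBundle 𝓘(ℝ, E) M) → TangentSpace 𝓘(ℝ, E).tangent u) :
    Prop where
  smooth : ContMDiffOn 𝓘(ℝ, E).tangent 𝓘(ℝ, E).tangent.tangent ∞
    (fun u => (⟨u, S u⟩ : TangentBundle 𝓘(ℝ, E).tangent (TangentBundle 𝓘(ℝ, E) M))) (slit E M)
  second_order : ∀ u ∈ slit E M,
    mfderiv 𝓘(ℝ, E).tangent 𝓘(ℝ, E) (TotalSpace.proj : TangentBundle 𝓘(ℝ, E) M → M) u (S u) = u.2
  bracket : ∀ u ∈ slit E M,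
    VectorField.mlieBracket 𝓘(ℝ, E).tangent liouville S u = S u

/-- The canonical spray of `F`: the spray `S` with `S(Xᵛ(E)) - Xᶜ(E) = 0` for every vector field
`X` on `M`, where `E` is the energy of `F`. -/
structure IsCanonicalSpray (F : TangentBundle 𝓘(ℝ, E) M → ℝ)
    (S : (u : TangentBundle 𝓘(ℝ, E) M) → TangentSpace 𝓘(ℝ, E).tangent u) : Prop where
  isSpray : IsSpray S
  eulerLagrange : ∀ X : (m : M) → TangentSpace 𝓘(ℝ, E) m, IsSmoothVF X → ∀ u ∈ slit E M,
    act S (act (vLift X) (energy F)) u - act (cLift X) (energy F) u = 0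

/-- `S'` differs from `S` by `-2 P Δ` for a positively `1`-homogeneous function `P`. -/
def ProjRelated (S S' : (u : TangentBundle 𝓘(ℝ, E) M) → TangentSpace 𝓘(ℝ, E).tangent u) : Prop :=
  ∃ P : TangentBundle 𝓘(ℝ, E) M → ℝ,
    (∀ (c : ℝ), 0 < c → ∀ u ∈ slit E M, P (scale c u) = c * P u) ∧
    ∀ u ∈ slit E M, S' u = S u - (2 * P u) • liouville u

end Tangent

section FibreBundle

variable {E : Type*} [NormedAddCommGroup E] [NormedSpace ℝ E]
  {M : Type*} [TopologicalSpace M] [ChartedSpace E M] [IsManifold 𝓘(ℝ, E) ∞ M]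
  {B : Type*} [NormedAddCommGroup B] [NormedSpace ℝ B]
  {N : Type*} [TopologicalSpace N] [ChartedSpace B N] [IsManifold 𝓘(ℝ, B) ∞ N]

/-- Smooth fibre bundles with typical fibre the manifold `P`: near every point of the base there
is a local trivialization that is a diffeomorphism onto its image. -/
def IsFibreBundle (C : Type*) [NormedAddCommGroup C] [NormedSpace ℝ C]
    (P : Type*) [TopologicalSpace P] [ChartedSpace C P]
    (pr : C^∞⟮𝓘(ℝ, E), M; 𝓘(ℝ, B), N⟯) : Prop :=
  ∀ n : N, ∃ e : Trivialization P (pr : M → N), n ∈ e.baseSet ∧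
    ContMDiffOn 𝓘(ℝ, E) (𝓘(ℝ, B).prod 𝓘(ℝ, C)) ∞ e e.source ∧
    ContMDiffOn (𝓘(ℝ, B).prod 𝓘(ℝ, C)) 𝓘(ℝ, E) ∞ e.toOpenPartialHomeomorph.symm e.target

/-- The pullback bundle `π*TN` over `M`; its points are pairs of a point `m` of `M` and a tangent
vector of `N` at `π m`. -/
abbrev PullTN (pr : C^∞⟮𝓘(ℝ, E), M; 𝓘(ℝ, B), N⟯) :=
  TotalSpace B ((pr : M → N) *ᵖ (TangentSpace 𝓘(ℝ, B) : N → Type _))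

/-- The slit pullback bundle. -/
def slitPull (pr : C^∞⟮𝓘(ℝ, E), M; 𝓘(ℝ, B), N⟯) : Set (PullTN pr) :=
  {p | (Pullback.lift pr p : TangentBundle 𝓘(ℝ, B) N) ∈ slit B N}

/-- Fibrewise multiplication in `π*TN` by a real number. -/
def pullScale (pr : C^∞⟮𝓘(ℝ, E), M; 𝓘(ℝ, B), N⟯) (c : ℝ) (p : PullTN pr) : PullTN pr :=
  ⟨p.1, c • p.2⟩

/-- Nonlinear splittings of `π`. -/
structure IsNonlinearSplitting (pr : C^∞⟮𝓘(ℝ, E), M; 𝓘(ℝ, B), N⟯)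
    (h : PullTN pr → TangentBundle 𝓘(ℝ, E) M) : Prop where
  smooth : ContMDiffOn (𝓘(ℝ, E).prod 𝓘(ℝ, B)) 𝓘(ℝ, E).tangent ∞ h (slitPull pr)
  fibre_preserving : ∀ p, (h p).proj = p.proj
  section_eq : ∀ p, tangentMap 𝓘(ℝ, E) 𝓘(ℝ, B) pr (h p) = Pullback.lift pr p

/-- Positive homogeneity of degree one of a map `h : π*TN → TM`. -/
def IsHomogeneous (pr : C^∞⟮𝓘(ℝ, E), M; 𝓘(ℝ, B), N⟯)
    (h : PullTN pr → TangentBundle 𝓘(ℝ, E) M) : Prop :=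
  ∀ (c : ℝ), 0 < c → ∀ p, h (pullScale pr c p) = scale c (h p)

/-- Smooth `π`-vertical vector fields on `M`. -/
def IsVerticalVF (pr : C^∞⟮𝓘(ℝ, E), M; 𝓘(ℝ, B), N⟯)
    (Y : (m : M) → TangentSpace 𝓘(ℝ, E) m) : Prop :=
  IsSmoothVF Y ∧ ∀ m, mfderiv 𝓘(ℝ, E) 𝓘(ℝ, B) pr m (Y m) = 0

/-- The relation that determines the map `h : π*TN → TM` induced by `F`: it is fibre-preserving, a
right inverse of `(τ, Tπ)`, and `Yᵛ(E) ∘ h = 0` for every `π`-vertical vector field `Y`, i.e. in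
adapted coordinates `∂E/∂wᵅ ∘ h = 0`. No regularity of `h` is asked for. -/
structure IsInduced (pr : C^∞⟮𝓘(ℝ, E), M; 𝓘(ℝ, B), N⟯) (F : TangentBundle 𝓘(ℝ, E) M → ℝ)
    (h : PullTN pr → TangentBundle 𝓘(ℝ, E) M) : Prop where
  fibre_preserving : ∀ p, (h p).proj = p.proj
  section_eq : ∀ p, tangentMap 𝓘(ℝ, E) 𝓘(ℝ, B) pr (h p) = Pullback.lift pr p
  critical : ∀ Y : (m : M) → TangentSpace 𝓘(ℝ, E) m, IsVerticalVF pr Y →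
    ∀ p, act (vLift Y) (energy F) (h p) = 0

/-- The vector field `S` (on the slit tangent bundle) is tangent to the submanifold `Im h`: at
every `h p` it lies in the tangent space of the image, the range of the derivative of `h`. -/
def IsTangentToIm (pr : C^∞⟮𝓘(ℝ, E), M; 𝓘(ℝ, B), N⟯)
    (h : PullTN pr → TangentBundle 𝓘(ℝ, E) M)
    (S : (u : TangentBundle 𝓘(ℝ, E) M) → TangentSpace 𝓘(ℝ, E).tangent u) : Prop :=
  ∀ p ∈ slitPull pr, ∃ ξ : TangentSpace (𝓘(ℝ, E).prod 𝓘(ℝ, B)) p,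
    mfderiv (𝓘(ℝ, E).prod 𝓘(ℝ, B)) 𝓘(ℝ, E).tangent h p ξ = S (h p)

end FibreBundle

end FinslerSplitting

end

/-!
The energy `E = F² / 2` restricted to a tangent space is a function that is smooth and strictly
convex off the origin, positively homogeneous of degree two and positive off the origin; such
functions are called Minkowski energies below. The conditions on the induced splitting at a point
`(m, v)` of `π*TN` say that `h(m, v)` is a critical point of this function on the affine subspace
`Tπ⁻¹(v)` of `T_mM`. For this reading two facts are needed: `π` is a submersion
(`IsFibreBundle.surjective_baseDeriv`), and every vertical vector is the value of a global smooth
vertical vector field (`exists_isVerticalVF`). Existence of the critical point follows by minimizing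
the energy, which is coercive; uniqueness follows from strict convexity along lines that avoid the
origin, and from Euler's relation when `v = 0`.

Smoothness comes from the implicit function theorem, applied in natural coordinates to the system of
Lagrange multiplier equations `A(q) u = v`, `∂E/∂u = l ∘ A(q)` for the unknowns `(u, l)`, where
`A(q)` is the coordinate expression of `Tπ` (`exists_contDiffAt_critical`). Its linearization is
injective because the Hessian of the energy is positive definite and `A(q)` is surjective. By
uniqueness of critical points the solution is the induced splitting. Working with multipliers
avoids fibre coordinates adapted to `π`.

For the tangency statements the tangent space of the image of `h` is identified with the common
kernel of the differentials of the functions `Yᵛ(E)` with `Y` vertical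
(`IsFinsler.mem_range_mfderiv_iff`). Thus `S` is tangent to the image if and only if all `S(Yᵛ(E))`
vanish on it, and `S(Yᵛ(E)) = Yᶜ(E)` for the canonical spray. The homogeneity of `h` makes the
Liouville field tangent to the image (`IsHomogeneous.mfderiv_eq_liouville`), so tangency is
inherited by projectively related sprays.
-/

noncomputable section

namespace FinslerSplitting

/-! ### Natural coordinates on the tangent bundle -/

section NaturalCoordinates

variable {E : Type*} [NormedAddCommGroup E] [NormedSpace ℝ E]

theorem mfderiv_extChartAt_self {H : Type*} [TopologicalSpace H] (I : ModelWithCorners ℝ E H)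
    {M : Type*} [TopologicalSpace M] [ChartedSpace H M] [IsManifold I 1 M] (m : M) (w : E) :
    mfderiv I 𝓘(ℝ, E) (extChartAt I m) m w = w := by
  rw [← TangentBundle.continuousLinearMapAt_trivializationAt (mem_chart_source H m),
    TangentBundle.continuousLinearMapAt_trivializationAt_eq_core (mem_chart_source H m)]
  exact (tangentBundleCore I M).coordChange_self (achart H m) m (mem_chart_source H m) w

theorem mfderiv_extChartAt_symm_self {H : Type*} [TopologicalSpace H]
    (I : ModelWithCorners ℝ E H) [I.Boundaryless] {M : Type*} [TopologicalSpace M]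
    [ChartedSpace H M] [IsManifold I 1 M] (m : M) (w : E) :
    mfderiv 𝓘(ℝ, E) I (extChartAt I m).symm (extChartAt I m m) w = w := by
  rw [← mfderivWithin_univ, ← I.range_eq_univ,
    ← TangentBundle.symmL_trivializationAt (mem_chart_source H m),
    TangentBundle.symmL_trivializationAt_eq_core (mem_chart_source H m)]
  exact (tangentBundleCore I M).coordChange_self (achart H m) m (mem_chart_source H m) w

variable {M : Type*} [TopologicalSpace M] [ChartedSpace E M] [IsManifold 𝓘(ℝ, E) ∞ M]

/-- The tangent space of `TM` at `u` is by definition the model space `E × E`, identified through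
the preferred chart at `u`; for this identification natural components are plain components. -/
theorem natVec_eq (u : TangentBundle 𝓘(ℝ, E) M) (a b : E) : natVec u a b = ((a, b) : E × E) :=
  mfderiv_extChartAt_symm_self 𝓘(ℝ, E).tangent u ((a, b) : E × E)

theorem comps_self (X : (m : M) → TangentSpace 𝓘(ℝ, E) m) (m : M) :
    comps m X (extChartAt 𝓘(ℝ, E) m m) = X m := by
  have h : (extChartAt 𝓘(ℝ, E) m).symm (extChartAt 𝓘(ℝ, E) m m) = m := extChartAt_to_inv m
  unfold comps
  rw [h]
  exact mfderiv_extChartAt_self 𝓘(ℝ, E) m (X m)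

theorem vLift_eq (Y : (m : M) → TangentSpace 𝓘(ℝ, E) m) (u : TangentBundle 𝓘(ℝ, E) M) :
    vLift Y u = ((0, Y u.1) : E × E) := by
  unfold vLift
  rw [natVec_eq, comps_self]

theorem liouville_eq (u : TangentBundle 𝓘(ℝ, E) M) : liouville u = ((0, u.2) : E × E) := by
  refine (natVec_eq u 0 (fibreCoord u)).trans ?_
  exact congrArg (fun w : E => ((0, w) : E × E)) (mfderiv_extChartAt_self 𝓘(ℝ, E) u.1 u.2)

/-- The inclusion of the tangent space at `m`, identified with the model space by the preferred
chart at `m`, into the tangent bundle. -/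
def fibreIncl (m : M) (w : E) : TangentBundle 𝓘(ℝ, E) M := ⟨m, w⟩

theorem trivializationAt_fibreIncl_self (m : M) (w : E) :
    (trivializationAt E (TangentSpace 𝓘(ℝ, E)) m (fibreIncl m w)).2 = w :=
  (tangentBundleCore 𝓘(ℝ, E) M).coordChange_self (achart E m) m (mem_chart_source E m) w

theorem contMDiff_fibreIncl (m : M) :
    ContMDiff 𝓘(ℝ, E) 𝓘(ℝ, E).tangent ∞ (fibreIncl (E := E) m) := by
  intro w
  refine Bundle.contMDiffAt_totalSpace.2 ⟨contMDiffAt_const, ?_⟩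
  exact contMDiffAt_id.congr_of_eventuallyEq
    (Filter.Eventually.of_forall fun w' => trivializationAt_fibreIncl_self m w')

/-- In natural coordinates the fibre inclusion is `w ↦ (const, w)`. -/
theorem hasMFDerivAt_fibreIncl (m : M) (u : E) :
    HasMFDerivAt 𝓘(ℝ, E) 𝓘(ℝ, E).tangent (fibreIncl (E := E) m) u
      (ContinuousLinearMap.inr ℝ E E) := by
  refine ⟨(contMDiff_fibreIncl m).continuous.continuousAt, ?_⟩
  have : HasFDerivAt (fun w : E => (extChartAt 𝓘(ℝ, E) m m, w))
      (ContinuousLinearMap.inr ℝ E E) u :=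
    (hasFDerivAt_const _ _).prodMk (hasFDerivAt_id u)
  refine this.hasFDerivWithinAt.congr (fun w _ => ?_) ?_
  all_goals exact Prod.ext rfl (trivializationAt_fibreIncl_self m _)

theorem hasMFDerivAt_tangentBundle_proj (u : TangentBundle 𝓘(ℝ, E) M) :
    HasMFDerivAt 𝓘(ℝ, E).tangent 𝓘(ℝ, E) (TotalSpace.proj : TangentBundle 𝓘(ℝ, E) M → M) u
      (ContinuousLinearMap.fst ℝ E E) := by
  refine ⟨(contMDiff_proj (TangentSpace 𝓘(ℝ, E)) (n := ∞) (IB := 𝓘(ℝ, E))).continuous.continuousAt,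
    ?_⟩
  refine (hasFDerivAt_fst (p := extChartAt 𝓘(ℝ, E).tangent u u)).hasFDerivWithinAt
    |>.congr_of_eventuallyEq ?_ ((extChartAt 𝓘(ℝ, E) u.1).right_inv (mem_extChartAt_target u.1))
  have h1 : ∀ᶠ x : E × E in nhds (extChartAt 𝓘(ℝ, E).tangent u u),
      x.1 ∈ (extChartAt 𝓘(ℝ, E) u.1).target :=
    continuous_fst.continuousAt.eventually (extChartAt_target_mem_nhds (I := 𝓘(ℝ, E)) u.1)
  filter_upwards [mem_nhdsWithin_of_mem_nhds h1] with x hx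
  exact (extChartAt 𝓘(ℝ, E) u.1).right_inv hx

/-- The inverse of the local trivialization of `TM` over the preferred chart at `m₀`: the
vector with natural coordinates `x = (q, u)`. -/
def natPoint (m₀ : M) (x : E × E) : TangentBundle 𝓘(ℝ, E) M :=
  ⟨(extChartAt 𝓘(ℝ, E) m₀).symm x.1,
    (trivializationAt E (TangentSpace 𝓘(ℝ, E)) m₀).symmL ℝ ((extChartAt 𝓘(ℝ, E) m₀).symm x.1) x.2⟩

/-- The fibre part of the natural coordinates over the preferred chart at `m₀`. -/
def fibreTriv (m₀ m : M) : E →L[ℝ] E :=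
  (trivializationAt E (TangentSpace 𝓘(ℝ, E)) m₀).continuousLinearMapAt ℝ m

theorem fibreTriv_apply {m₀ m : M} (hm : m ∈ (chartAt E m₀).source) (w : E) :
    fibreTriv m₀ m w = (trivializationAt E (TangentSpace 𝓘(ℝ, E)) m₀ (fibreIncl m w)).2 :=
  (trivializationAt E (TangentSpace 𝓘(ℝ, E)) m₀).continuousLinearMapAt_apply_of_mem (R := ℝ) hm w

theorem fibreTriv_self (m₀ : M) (w : E) : fibreTriv m₀ m₀ w = w := by
  rw [fibreTriv_apply (mem_chart_source E m₀), trivializationAt_fibreIncl_self]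

theorem natPoint_coord {m₀ m : M} (hm : m ∈ (chartAt E m₀).source) (w : E) :
    natPoint m₀ (extChartAt 𝓘(ℝ, E) m₀ m, fibreTriv m₀ m w) = fibreIncl m w := by
  have h : (extChartAt 𝓘(ℝ, E) m₀).symm (extChartAt 𝓘(ℝ, E) m₀ m) = m :=
    (extChartAt 𝓘(ℝ, E) m₀).left_inv (by rwa [extChartAt_source])
  unfold natPoint
  dsimp only
  rw [h]
  exact congrArg (fibreIncl m)
    ((trivializationAt E (TangentSpace 𝓘(ℝ, E)) m₀).symmL_continuousLinearMapAt (R := ℝ) hm w)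

/-- The inverse of `fibreTriv m₀ m`. -/
def fibreTrivSymm (m₀ m : M) : E →L[ℝ] E :=
  (trivializationAt E (TangentSpace 𝓘(ℝ, E)) m₀).symmL ℝ m

theorem fibreTrivSymm_fibreTriv {m₀ m : M} (hm : m ∈ (chartAt E m₀).source) (w : E) :
    fibreTrivSymm m₀ m (fibreTriv m₀ m w) = w :=
  (trivializationAt E (TangentSpace 𝓘(ℝ, E)) m₀).symmL_continuousLinearMapAt (R := ℝ) hm w

theorem fibreTriv_fibreTrivSymm {m₀ m : M} (hm : m ∈ (chartAt E m₀).source) (w : E) :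
    fibreTriv m₀ m (fibreTrivSymm m₀ m w) = w :=
  (trivializationAt E (TangentSpace 𝓘(ℝ, E)) m₀).continuousLinearMapAt_symmL (R := ℝ) hm w

theorem natPoint_eq (m₀ : M) (x : E × E) : natPoint m₀ x =
    fibreIncl ((extChartAt 𝓘(ℝ, E) m₀).symm x.1)
      (fibreTrivSymm m₀ ((extChartAt 𝓘(ℝ, E) m₀).symm x.1) x.2) := rfl

theorem contMDiffAt_natPoint {m₀ : M} {x : E × E} (hx : x.1 ∈ (extChartAt 𝓘(ℝ, E) m₀).target) :
    ContMDiffAt 𝓘(ℝ, E × E) 𝓘(ℝ, E).tangent ∞ (natPoint m₀) x := by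
  have hs : ∀ y : E × E, y.1 ∈ (extChartAt 𝓘(ℝ, E) m₀).target →
      (extChartAt 𝓘(ℝ, E) m₀).symm y.1 ∈ (chartAt E m₀).source := fun y hy => by
    have := (extChartAt 𝓘(ℝ, E) m₀).map_target hy
    rwa [extChartAt_source] at this
  have ho : ∀ᶠ y : E × E in nhds x, y.1 ∈ (extChartAt 𝓘(ℝ, E) m₀).target :=
    continuous_fst.continuousAt.eventually ((isOpen_extChartAt_target m₀).mem_nhds hx)
  refine ((trivializationAt E (TangentSpace 𝓘(ℝ, E)) m₀).contMDiffAt_iff ?_).2 ⟨?_, ?_⟩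
  · rw [Trivialization.mem_source]
    exact hs x hx
  · have h1 : ContMDiffAt 𝓘(ℝ, E) 𝓘(ℝ, E) ∞ (extChartAt 𝓘(ℝ, E) m₀).symm x.1 :=
      (contMDiffOn_extChartAt_symm m₀).contMDiffAt ((isOpen_extChartAt_target m₀).mem_nhds hx)
    exact h1.comp x (contDiff_fst.contMDiff.contMDiffAt)
  · have h2 : ContMDiffAt 𝓘(ℝ, E × E) 𝓘(ℝ, E) ∞ (Prod.snd : E × E → E) x :=
      contDiff_snd.contMDiff.contMDiffAt
    refine h2.congr_of_eventuallyEq ?_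
    filter_upwards [ho] with y hy
    rw [natPoint_eq, ← fibreTriv_apply (hs y hy), fibreTriv_fibreTrivSymm (hs y hy)]

theorem contMDiffAt_fibreTriv {m₀ : M} {u : TangentBundle 𝓘(ℝ, E) M}
    (hu : u.1 ∈ (chartAt E m₀).source) :
    ContMDiffAt 𝓘(ℝ, E).tangent 𝓘(ℝ, E) ∞
      (fun u : TangentBundle 𝓘(ℝ, E) M => fibreTriv m₀ u.1 u.2) u := by
  have h := ((trivializationAt E (TangentSpace 𝓘(ℝ, E)) m₀).contMDiffAt_iff (n := ∞) (IB := 𝓘(ℝ, E))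
    (IM := 𝓘(ℝ, E).tangent) (f := fun u => u) (x₀ := u) (by rwa [Trivialization.mem_source])).1
    contMDiffAt_id
  refine h.2.congr_of_eventuallyEq ?_
  have : ∀ᶠ u' : TangentBundle 𝓘(ℝ, E) M in nhds u, u'.1 ∈ (chartAt E m₀).source :=
    (FiberBundle.continuous_proj E (TangentSpace 𝓘(ℝ, E))).continuousAt.eventually
      ((chartAt E m₀).open_source.mem_nhds hu)
  filter_upwards [this] with u' hu'
  exact fibreTriv_apply hu' u'.2

theorem isOpen_slit : IsOpen (slit E M) := by
  rw [isOpen_iff_mem_nhds]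
  intro u hu
  have hc := (contMDiffAt_fibreTriv (m₀ := u.1) (u := u) (mem_chart_source E u.1)).continuousAt
  have : (fun u' : TangentBundle 𝓘(ℝ, E) M => (fibreTriv u.1 u'.1 u'.2 : E)) u ≠ (0 : E) :=
    fun h => hu ((fibreTriv_self (E := E) u.1 u.2).symm.trans h)
  filter_upwards [hc.eventually_ne this] with u' hu' h0
  exact hu' ((congrArg _ h0).trans (map_zero (fibreTriv (E := E) u.1 u'.1)))

end NaturalCoordinates

/-! ### Minkowski energies on a vector space -/

section MinkowskiEnergy

variable {E : Type*} [NormedAddCommGroup E] [NormedSpace ℝ E]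

/-- The energy of a Minkowski norm on a vector space: a continuous function, smooth off the origin,
positively homogeneous of degree two, whose second derivative off the origin is positive definite.
These are the restrictions of Finsler energies to tangent spaces. -/
structure IsMinkowskiEnergy (e : E → ℝ) : Prop where
  continuous : Continuous e
  smooth : ∀ u, u ≠ 0 → ContDiffAt ℝ ∞ e u
  homogeneous : ∀ (c : ℝ) (u : E), 0 < c → e (c • u) = c ^ 2 * e u
  convex : ∀ u w : E, u ≠ 0 → w ≠ 0 → 0 < deriv (deriv fun t : ℝ => e (u + t • w)) 0

namespace IsMinkowskiEnergy

variable {e : E → ℝ} (he : IsMinkowskiEnergy e)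
include he

theorem hasDerivAt_line {u w : E} {t : ℝ} (h : u + t • w ≠ 0) :
    HasDerivAt (fun t : ℝ => e (u + t • w)) (fderiv ℝ e (u + t • w) w) t := by
  have h1 : HasFDerivAt e (fderiv ℝ e (u + t • w)) (u + t • w) :=
    ((he.smooth _ h).differentiableAt (by simp)).hasFDerivAt
  have h2 : HasDerivAt (fun t : ℝ => u + t • w) w t := by
    simpa using ((hasDerivAt_id t).smul_const w).const_add u
  exact h1.comp_hasDerivAt t h2

theorem apply_zero : e 0 = 0 := by
  have := he.homogeneous 2 0 two_pos
  rw [smul_zero] at this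
  linarith

/-- Along a ray the energy is `t ↦ (1 + t)² e(u)`, whose second derivative is `2 e(u)`. -/
theorem pos {u : E} (hu : u ≠ 0) : 0 < e u := by
  have h := he.convex u u hu hu
  have h1 : (fun t : ℝ => e (u + t • u)) =ᶠ[nhds 0] fun t => (1 + t) ^ 2 * e u := by
    filter_upwards [Ioi_mem_nhds (show (-1 : ℝ) < 0 by norm_num)] with t ht
    rw [← he.homogeneous (1 + t) u (by linarith [mem_Ioi.1 ht]), add_smul, one_smul]
  have h2 : (deriv fun t : ℝ => (1 + t) ^ 2 * e u) = fun t => 2 * (1 + t) * e u := by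
    funext t
    have : HasDerivAt (fun t : ℝ => (1 + t) ^ 2 * e u) (2 * (1 + t) * e u) t := by
      simpa using (((hasDerivAt_id t).const_add 1).pow 2).mul_const (e u)
    exact this.deriv
  have h3 : HasDerivAt (fun t : ℝ => 2 * (1 + t) * e u) (2 * e u) 0 := by
    simpa using ((((hasDerivAt_id (0 : ℝ)).const_add 1).const_mul 2).mul_const (e u))
  rw [h1.deriv.deriv_eq, h2, h3.deriv] at h
  linarith

theorem nonneg (u : E) : 0 ≤ e u := by
  by_cases hu : u = 0
  · rw [hu, he.apply_zero]
  · exact (he.pos hu).le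

/-- The origin is a minimum, so the derivative vanishes there. -/
theorem fderiv_zero : fderiv ℝ e 0 = 0 :=
  IsLocalMin.fderiv_eq_zero (Filter.Eventually.of_forall fun u => by
    rw [he.apply_zero]; exact he.nonneg u)

/-- Euler's relation. -/
theorem fderiv_self {u : E} (hu : u ≠ 0) : fderiv ℝ e u u = 2 * e u := by
  have h1 : HasDerivAt (fun t : ℝ => e (u + t • u)) (fderiv ℝ e u u) 0 := by
    have := he.hasDerivAt_line (u := u) (w := u) (t := 0) (by simpa using hu)
    simpa using this
  have h2 : (fun t : ℝ => e (u + t • u)) =ᶠ[nhds 0] fun t => (1 + t) ^ 2 * e u := by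
    filter_upwards [Ioi_mem_nhds (show (-1 : ℝ) < 0 by norm_num)] with t ht
    rw [← he.homogeneous (1 + t) u (by linarith [mem_Ioi.1 ht]), add_smul, one_smul]
  have h3 : HasDerivAt (fun t : ℝ => (1 + t) ^ 2 * e u) (2 * e u) 0 := by
    simpa using (((hasDerivAt_id (0 : ℝ)).const_add 1).pow 2).mul_const (e u)
  exact h1.unique (h3.congr_of_eventuallyEq h2)

theorem hessian_eq {u : E} (hu : u ≠ 0) (w : E) :
    deriv (deriv fun t : ℝ => e (u + t • w)) 0 = fderiv ℝ (fderiv ℝ e) u w w := by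
  have hc : ContinuousAt (fun t : ℝ => u + t • w) 0 := by fun_prop
  have h1 : (deriv fun t : ℝ => e (u + t • w)) =ᶠ[nhds 0] fun t => fderiv ℝ e (u + t • w) w := by
    filter_upwards [hc.eventually_ne (by simpa using hu)] with t ht
    exact (he.hasDerivAt_line ht).deriv
  have h2 : HasFDerivAt (fderiv ℝ e) (fderiv ℝ (fderiv ℝ e) u) (u + (0 : ℝ) • w) := by
    have : ContDiffAt ℝ ∞ (fderiv ℝ e) u := (he.smooth u hu).fderiv_right le_rfl
    simpa only [zero_smul, add_zero] using (this.differentiableAt (by simp)).hasFDerivAt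
  have h3 : HasDerivAt (fun t : ℝ => u + t • w) w 0 := by
    simpa using ((hasDerivAt_id (0 : ℝ)).smul_const w).const_add u
  have h4 : HasDerivAt (fun t : ℝ => fderiv ℝ e (u + t • w)) (fderiv ℝ (fderiv ℝ e) u w) 0 :=
    h2.comp_hasDerivAt (0 : ℝ) h3
  have h5 := h4.clm_apply (hasDerivAt_const (0 : ℝ) w)
  rw [ContinuousLinearMap.map_zero, add_zero] at h5
  rw [h1.deriv_eq, h5.deriv]

theorem hessian_pos {u w : E} (hu : u ≠ 0) (hw : w ≠ 0) : 0 < fderiv ℝ (fderiv ℝ e) u w w := by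
  rw [← he.hessian_eq hu]
  exact he.convex u w hu hw

theorem fderiv_smul {c : ℝ} (hc : 0 < c) (u w : E) :
    fderiv ℝ e (c • u) w = c * fderiv ℝ e u w := by
  have h1 : (fun u => e (c • u)) = c ^ 2 • e := funext fun u => he.homogeneous c u hc
  have h2 : fderiv ℝ (fun u => e (c • u)) u = c • fderiv ℝ e (c • u) := fderiv_comp_smul c
  rw [h1, fderiv_const_smul_field] at h2
  have h3 : c ^ 2 * fderiv ℝ e u w = c * fderiv ℝ e (c • u) w :=
    congrArg (fun l : E →L[ℝ] ℝ => l w) h2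
  have h4 : c * (c * fderiv ℝ e u w) = c * fderiv ℝ e (c • u) w := by rw [← h3]; ring
  exact (mul_left_cancel₀ hc.ne' h4).symm

variable {B : Type*} [NormedAddCommGroup B] [NormedSpace ℝ B]

/-- Along an affine line that avoids the origin the energy is strictly convex, so an affine
subspace `A⁻¹(v)` carries at most one critical point of the energy; a nonzero critical point on
the linear subspace `ker A` is excluded by Euler's relation. -/
theorem critical_unique (A : E →L[ℝ] B) {u₁ u₂ : E} (hA : A u₁ = A u₂)
    (h₁ : ∀ w, A w = 0 → fderiv ℝ e u₁ w = 0) (h₂ : ∀ w, A w = 0 → fderiv ℝ e u₂ w = 0) :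
    u₁ = u₂ := by
  have hz : ∀ u, A u = 0 → (∀ w, A w = 0 → fderiv ℝ e u w = 0) → u = 0 := fun u hu h => by
    by_contra h0
    have := he.fderiv_self h0
    rw [h u hu] at this
    linarith [he.pos h0]
  by_cases hv : A u₁ = 0
  · rw [hz u₁ hv h₁, hz u₂ (hA ▸ hv) h₂]
  by_contra hne
  set d := u₂ - u₁ with hd
  have hd0 : d ≠ 0 := sub_ne_zero.2 (Ne.symm hne)
  have hAd : A d = 0 := by rw [hd, map_sub, hA, sub_self]
  have hl : ∀ t : ℝ, u₁ + t • d ≠ 0 := fun t h => hv <| by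
    have := congrArg A h
    simpa [hAd] using this
  have hderiv : ∀ t : ℝ, deriv (fun t : ℝ => e (u₁ + t • d)) t = fderiv ℝ e (u₁ + t • d) d :=
    fun t => (he.hasDerivAt_line (hl t)).deriv
  have hmono : StrictMono (deriv fun t : ℝ => e (u₁ + t • d)) := by
    refine strictMono_of_deriv_pos fun t => ?_
    have h := he.convex _ d (hl t) hd0
    have h1 : (deriv fun s : ℝ => e (u₁ + t • d + s • d)) =
        fun s => deriv (fun t : ℝ => e (u₁ + t • d)) (t + s) := by
      funext s
      rw [← deriv_comp_const_add (f := fun t : ℝ => e (u₁ + t • d))]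
      congr 1
      funext r
      rw [add_smul, add_assoc]
    rw [h1, deriv_comp_const_add (f := deriv fun t : ℝ => e (u₁ + t • d)), add_zero] at h
    exact h
  have h01 := hmono (zero_lt_one (α := ℝ))
  rw [hderiv, hderiv, zero_smul, one_smul, add_zero, h₁ d hAd, hd, add_sub_cancel, ← hd,
    h₂ d hAd] at h01
  exact lt_irrefl _ h01

/-- By compactness of the unit sphere and homogeneity, the energy dominates a positive multiple of
the squared norm. -/
theorem exists_mul_sq_le [FiniteDimensional ℝ E] : ∃ c : ℝ, 0 < c ∧ ∀ u, c * ‖u‖ ^ 2 ≤ e u := by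
  obtain ⟨c, hc, h⟩ : ∃ c : ℝ, 0 < c ∧ ∀ u ∈ Metric.sphere (0 : E) 1, c ≤ e u := by
    rcases (Metric.sphere (0 : E) 1).eq_empty_or_nonempty with h | h
    · exact ⟨1, one_pos, fun u hu => by simp [h] at hu⟩
    · have hK : IsCompact (Metric.sphere (0 : E) 1) :=
        have := FiniteDimensional.proper_real E
        isCompact_sphere 0 1
      obtain ⟨u, hu, hmin⟩ := hK.exists_isMinOn h he.continuous.continuousOn
      refine ⟨e u, he.pos ?_, fun w hw => hmin hw⟩
      rintro rfl
      simp at hu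
  refine ⟨c, hc, fun u => ?_⟩
  by_cases hu : u = 0
  · simp [hu, he.apply_zero]
  have hn : 0 < ‖u‖ := norm_pos_iff.2 hu
  have h1 := h (‖u‖⁻¹ • u) (by simp [norm_smul, hn.ne'])
  rw [he.homogeneous _ _ (inv_pos.2 hn), inv_pow, inv_mul_eq_div, le_div_iff₀ (by positivity)] at h1
  exact h1

theorem exists_critical [FiniteDimensional ℝ E] (A : E →L[ℝ] B) (hA : Function.Surjective A)
    (v : B) : ∃ u, A u = v ∧ ∀ w, A w = 0 → fderiv ℝ e u w = 0 := by
  obtain ⟨u₀, hu₀⟩ := hA v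
  obtain ⟨c, hc, hle⟩ := he.exists_mul_sq_le
  have := FiniteDimensional.proper_real E
  have hK : IsCompact {u | A u = v ∧ e u ≤ e u₀} := by
    refine Metric.isCompact_of_isClosed_isBounded ?_ ?_
    · exact (isClosed_eq A.continuous continuous_const).inter
        (isClosed_le he.continuous continuous_const)
    · refine (Metric.isBounded_closedBall (x := (0 : E)) (r := e u₀ / c + 1)).subset fun u hu => ?_
      rw [mem_closedBall_zero_iff]
      have h1 : ‖u‖ ^ 2 ≤ e u₀ / c := by
        rw [le_div_iff₀ hc, mul_comm]
        exact (hle u).trans hu.2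
      nlinarith [sq_nonneg (‖u‖ - 1 / 2)]
  obtain ⟨u, hu, hmin⟩ := hK.exists_isMinOn ⟨u₀, hu₀, le_rfl⟩ he.continuous.continuousOn
  refine ⟨u, hu.1, fun w hw => ?_⟩
  by_cases h0 : u = 0
  · rw [h0, he.fderiv_zero]
    rfl
  have h1 : HasDerivAt (fun t : ℝ => e (u + t • w)) (fderiv ℝ e u w) 0 := by
    have := he.hasDerivAt_line (u := u) (w := w) (t := 0) (by simpa using h0)
    simpa using this
  refine IsLocalMin.hasDerivAt_eq_zero (Filter.Eventually.of_forall fun t => ?_) h1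
  by_cases ht : e (u + t • w) ≤ e u₀
  · have := hmin (show u + t • w ∈ {u | A u = v ∧ e u ≤ e u₀} from ⟨by simp [hw, hu.1], ht⟩)
    simpa using this
  · simpa using hu.2.trans (not_le.1 ht).le

end IsMinkowskiEnergy

end MinkowskiEnergy

/-! ### Smooth dependence of constrained critical points on parameters -/

section ImplicitCritical

variable {E : Type*} [NormedAddCommGroup E] [NormedSpace ℝ E] [FiniteDimensional ℝ E]
  {B : Type*} [NormedAddCommGroup B] [NormedSpace ℝ B] [FiniteDimensional ℝ B]

/-- Smooth dependence of the critical points of the functions `f(q, ·)` on the affine subspaces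
`A(q) u = v` on the parameters `q` and `v`. -/
theorem exists_contDiffAt_critical {f : E × E → ℝ} {A : E → E →L[ℝ] B} {q₀ u₀ : E}
    (hf : ContDiffAt ℝ ∞ f (q₀, u₀)) (hA : ContDiffAt ℝ ∞ A q₀)
    (hsurj : Function.Surjective (A q₀))
    (hpos : ∀ w, w ≠ 0 → 0 < fderiv ℝ (fderiv ℝ f) (q₀, u₀) (0, w) (0, w))
    (hcrit : ∀ w, A q₀ w = 0 → fderiv ℝ f (q₀, u₀) (0, w) = 0) :
    ∃ g : E × B → E, ContDiffAt ℝ ∞ g (q₀, A q₀ u₀) ∧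
      ∀ᶠ y : E × B in nhds (q₀, A q₀ u₀), A y.1 (g y) = y.2 ∧
        ∀ w, A y.1 w = 0 → fderiv ℝ f (y.1, g y) (0, w) = 0 := by
  -- Lagrange multipliers: with `l ∈ B*` as an additional unknown, the critical points are the zeros
  -- of `(A(q) u - v, ∂ᵤf(q, u) - l ∘ A(q))`.
  let R := ContinuousLinearMap.inr ℝ E E
  obtain ⟨s, hs⟩ := (A q₀ : E →ₗ[ℝ] B).exists_rightInverse_of_surjective
    (LinearMap.range_eq_top.2 hsurj)
  have hs' : ∀ b, A q₀ (s b) = b := fun b => LinearMap.congr_fun hs b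
  let l₀ : B →L[ℝ] ℝ := ((fderiv ℝ f (q₀, u₀)).comp R).comp (LinearMap.toContinuousLinearMap s)
  have hl₀ : ∀ w, fderiv ℝ f (q₀, u₀) (0, w) = l₀ (A q₀ w) := fun w => by
    have h := hcrit (w - s (A q₀ w)) (by rw [map_sub, hs', sub_self])
    have h2 : ((0, w) : E × E) = (0, w - s (A q₀ w)) + (0, s (A q₀ w)) := by simp
    rw [h2, map_add, h, zero_add]
    rfl
  let G : E × E × (B →L[ℝ] ℝ) → E × B × (E →L[ℝ] ℝ) := fun x =>
    (x.1, A x.1 x.2.1, (fderiv ℝ f (x.1, x.2.1)).comp R - x.2.2.comp (A x.1))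
  set x₀ : E × E × (B →L[ℝ] ℝ) := (q₀, u₀, l₀) with hx₀
  have hG₀ : G x₀ = (q₀, A q₀ u₀, 0) := by
    refine Prod.ext rfl (Prod.ext rfl ?_)
    ext w
    simpa [G, R, hx₀, sub_eq_zero] using hl₀ w
  have hdf : ContDiffAt ℝ ∞ (fderiv ℝ f) (q₀, u₀) := hf.fderiv_right le_rfl
  have hp : ContDiffAt ℝ ∞ (fun x : E × E × (B →L[ℝ] ℝ) => (x.1, x.2.1)) x₀ := by fun_prop
  have hA' : ContDiffAt ℝ ∞ (fun x : E × E × (B →L[ℝ] ℝ) => A x.1) x₀ :=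
    ContDiffAt.comp x₀ (g := A) hA contDiffAt_fst
  have hdf' : ContDiffAt ℝ ∞ (fun x : E × E × (B →L[ℝ] ℝ) => fderiv ℝ f (x.1, x.2.1)) x₀ :=
    ContDiffAt.comp x₀ (g := fderiv ℝ f) hdf hp
  have hG : ContDiffAt ℝ ∞ G x₀ := by
    refine contDiffAt_fst.prodMk (ContDiffAt.prodMk ?_ ?_)
    · exact hA'.clm_apply (contDiffAt_fst.comp x₀ contDiffAt_snd)
    · refine (hdf'.clm_comp contDiffAt_const).sub (ContDiffAt.clm_comp ?_ hA')
      exact contDiffAt_snd.comp x₀ contDiffAt_snd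
  have hGd : HasFDerivAt G (fderiv ℝ G x₀) x₀ := (hG.differentiableAt (by simp)).hasFDerivAt
  have hinj : Function.Injective (fderiv ℝ G x₀) := by
    rw [injective_iff_map_eq_zero]
    rintro ⟨a, w, l⟩ h0
    -- the first component of the derivative is `a`
    have ha : a = 0 := by
      have h1 : HasFDerivAt (fun x => (G x).1)
          ((ContinuousLinearMap.fst ℝ _ _).comp (fderiv ℝ G x₀)) x₀ := hasFDerivAt_fst.comp x₀ hGd
      have h2 : HasFDerivAt (fun x : E × E × (B →L[ℝ] ℝ) => x.1)
          (ContinuousLinearMap.fst ℝ _ _) x₀ := hasFDerivAt_fst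
      have h3 := congrArg (fun L => L (a, w, l)) (h1.unique h2)
      simpa [h0] using h3.symm
    subst ha
    -- the other components are computed along the line `t ↦ (q₀, u₀ + t w, l₀ + t l)`
    have hline : HasDerivAt (fun t : ℝ => x₀ + t • ((0, w, l) : E × E × (B →L[ℝ] ℝ)))
        (0, w, l) 0 := by
      simpa using
        ((hasDerivAt_id (0 : ℝ)).smul_const ((0, w, l) : E × E × (B →L[ℝ] ℝ))).const_add x₀
    have hcomp : HasDerivAt
        (fun t : ℝ => G (x₀ + t • ((0, w, l) : E × E × (B →L[ℝ] ℝ)))) 0 0 := by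
      have h1 : HasFDerivAt G (fderiv ℝ G x₀)
        (x₀ + (0 : ℝ) • ((0, w, l) : E × E × (B →L[ℝ] ℝ))) := by
        simpa only [zero_smul, add_zero] using hGd
      have h2 := h1.comp_hasDerivAt (0 : ℝ) hline
      rwa [h0] at h2
    have hAw : A q₀ w = 0 := by
      have h1 : HasDerivAt (fun t : ℝ => A q₀ (u₀ + t • w)) 0 0 := by
        have h2 : HasDerivAt
            (fun t : ℝ => (G (x₀ + t • ((0, w, l) : E × E × (B →L[ℝ] ℝ)))).2.1) 0 0 := by
          have h3 := ((ContinuousLinearMap.fst ℝ B (E →L[ℝ] ℝ)).comp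
            (ContinuousLinearMap.snd ℝ E (B × (E →L[ℝ] ℝ)))).hasFDerivAt.comp_hasDerivAt
              (0 : ℝ) hcomp
          rw [ContinuousLinearMap.map_zero] at h3
          exact h3
        simpa [G, hx₀] using h2
      have h3 : HasDerivAt (fun t : ℝ => A q₀ (u₀ + t • w)) (A q₀ w) 0 := by
        have : HasDerivAt (fun t : ℝ => u₀ + t • w) w 0 := by
          simpa using ((hasDerivAt_id (0 : ℝ)).smul_const w).const_add u₀
        exact (A q₀).hasFDerivAt.comp_hasDerivAt (0 : ℝ) this
      exact h3.unique h1
    have hH : ∀ w', fderiv ℝ (fderiv ℝ f) (q₀, u₀) (0, w) (0, w') - l (A q₀ w') = 0 := fun w' => by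
      have h1 : HasDerivAt
          (fun t : ℝ => fderiv ℝ f (q₀, u₀ + t • w) (0, w') - (l₀ + t • l) (A q₀ w')) 0 0 := by
        have h2 : HasDerivAt
            (fun t : ℝ => (G (x₀ + t • ((0, w, l) : E × E × (B →L[ℝ] ℝ)))).2.2) 0 0 := by
          have h3 := ((ContinuousLinearMap.snd ℝ B (E →L[ℝ] ℝ)).comp
            (ContinuousLinearMap.snd ℝ E (B × (E →L[ℝ] ℝ)))).hasFDerivAt.comp_hasDerivAt
              (0 : ℝ) hcomp
          rw [ContinuousLinearMap.map_zero] at h3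
          exact h3
        have h3 := h2.clm_apply (hasDerivAt_const (0 : ℝ) w')
        rw [ContinuousLinearMap.map_zero, add_zero] at h3
        simpa [G, hx₀, R] using h3
      have h4 : HasDerivAt (fun t : ℝ => fderiv ℝ f (q₀, u₀ + t • w))
          (fderiv ℝ (fderiv ℝ f) (q₀, u₀) (0, w)) 0 := by
        have h5 : HasFDerivAt (fderiv ℝ f) (fderiv ℝ (fderiv ℝ f) (q₀, u₀))
            (q₀, u₀ + (0 : ℝ) • w) := by
          simpa only [zero_smul, add_zero] using (hdf.differentiableAt (by simp)).hasFDerivAt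
        have h6 : HasDerivAt (fun t : ℝ => (q₀, u₀ + t • w)) ((0, w) : E × E) 0 := by
          refine (hasDerivAt_const (0 : ℝ) q₀).prodMk ?_
          simpa using ((hasDerivAt_id (0 : ℝ)).smul_const w).const_add u₀
        exact h5.comp_hasDerivAt (0 : ℝ) h6
      have h7 : HasDerivAt (fun t : ℝ => (l₀ + t • l) (A q₀ w')) (l (A q₀ w')) 0 := by
        simpa using ((hasDerivAt_id (0 : ℝ)).mul_const (l (A q₀ w'))).const_add (l₀ (A q₀ w'))
      have h8 := (h4.clm_apply (hasDerivAt_const (0 : ℝ) ((0, w') : E × E))).sub h7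
      rw [ContinuousLinearMap.map_zero, add_zero] at h8
      exact h8.unique h1
    -- evaluated on `w ∈ ker A(q₀)`, this leaves the Hessian, which is positive definite
    have hw : w = 0 := by
      by_contra hw
      have := hH w
      rw [hAw, map_zero, sub_zero] at this
      exact (hpos w hw).ne' this
    have hl : l = 0 := by
      ext b
      have := hH (s b)
      rw [hw, hs', Prod.mk_zero_zero, ContinuousLinearMap.map_zero] at this
      simpa using this
    rw [hw, hl]
    rfl
  have hdim : Module.finrank ℝ (E × E × (B →L[ℝ] ℝ)) = Module.finrank ℝ (E × B × (E →L[ℝ] ℝ)) := by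
    have hE : Module.finrank ℝ (E →L[ℝ] ℝ) = Module.finrank ℝ E := by
      rw [← (LinearMap.toContinuousLinearMap (𝕜 := ℝ) (E := E) (F' := ℝ)).finrank_eq]
      exact Subspace.dual_finrank_eq
    have hB : Module.finrank ℝ (B →L[ℝ] ℝ) = Module.finrank ℝ B := by
      rw [← (LinearMap.toContinuousLinearMap (𝕜 := ℝ) (E := B) (F' := ℝ)).finrank_eq]
      exact Subspace.dual_finrank_eq
    simp only [Module.finrank_prod, hE, hB]
    ring
  let G' : (E × E × (B →L[ℝ] ℝ)) ≃L[ℝ] (E × B × (E →L[ℝ] ℝ)) :=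
    (LinearEquiv.ofInjectiveOfFinrankEq (fderiv ℝ G x₀ : _ →ₗ[ℝ] _) hinj
      hdim).toContinuousLinearEquiv
  have hG' : HasFDerivAt G (G' : _ →L[ℝ] _) x₀ := hGd
  let k := hG.localInverse hG' (by simp)
  have hk : ContDiffAt ℝ ∞ k (G x₀) := hG.to_localInverse hG' (by simp)
  have hGk : ∀ᶠ y in nhds (G x₀), G (k y) = y :=
    (hG.hasStrictFDerivAt' hG' (by simp)).eventually_right_inverse
  let i : E × B → E × B × (E →L[ℝ] ℝ) := fun y => (y.1, y.2, 0)
  have hi : ContDiff ℝ ∞ i := contDiff_fst.prodMk (contDiff_snd.prodMk contDiff_const)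
  have hi₀ : i (q₀, A q₀ u₀) = G x₀ := hG₀.symm
  refine ⟨fun y => (k (i y)).2.1, ?_, ?_⟩
  · have h1 : ContDiffAt ℝ ∞ (k ∘ i) (q₀, A q₀ u₀) :=
      ContDiffAt.comp _ (hi₀ ▸ hk) hi.contDiffAt
    exact contDiffAt_fst.comp _ (contDiffAt_snd.comp _ h1)
  · have h1 : ∀ᶠ y in nhds (q₀, A q₀ u₀), G (k (i y)) = i y :=
      hi.continuous.continuousAt.eventually (hi₀ ▸ hGk)
    filter_upwards [h1] with y hy
    have e1 : (k (i y)).1 = y.1 := congrArg Prod.fst hy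
    have e2 : A (k (i y)).1 (k (i y)).2.1 = y.2 := congrArg (fun z => z.2.1) hy
    have e3 : (fderiv ℝ f ((k (i y)).1, (k (i y)).2.1)).comp R -
      (k (i y)).2.2.comp (A (k (i y)).1) = 0 := congrArg (fun z => z.2.2) hy
    rw [e1] at e2 e3
    refine ⟨e2, fun w hw => ?_⟩
    have e4 := congrArg (fun L : E →L[ℝ] ℝ => L w) (sub_eq_zero.1 e3)
    simpa [R, hw] using e4

end ImplicitCritical

/-! ### Submersions and vertical vector fields -/

section Submersion

/-- Pointwise version of `contDiffOn_clm_apply`. -/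
theorem contDiffAt_of_clm_apply {D E F : Type*} [NormedAddCommGroup D] [NormedSpace ℝ D]
    [NormedAddCommGroup E] [NormedSpace ℝ E] [FiniteDimensional ℝ E] [NormedAddCommGroup F]
    [NormedSpace ℝ F] {n : ℕ∞ω} {f : D → E →L[ℝ] F} {x : D}
    (h : ∀ y, ContDiffAt ℝ n (fun x => f x y) x) : ContDiffAt ℝ n f x := by
  let d := Module.finrank ℝ E
  let e₁ : E ≃L[ℝ] (Fin d → ℝ) :=
    ContinuousLinearEquiv.ofFinrankEq (Module.finrank_fin_fun ℝ).symm
  let e₂ := (e₁.arrowCongr (1 : F ≃L[ℝ] F)).trans (ContinuousLinearEquiv.piRing (Fin d))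
  rw [← Function.id_comp f, ← e₂.symm_comp_self]
  exact e₂.symm.contDiff.contDiffAt.comp x (contDiffAt_pi.2 fun i => h _)

variable {E : Type*} [NormedAddCommGroup E] [NormedSpace ℝ E]
  {M : Type*} [TopologicalSpace M] [ChartedSpace E M]
  {B : Type*} [NormedAddCommGroup B] [NormedSpace ℝ B]
  {N : Type*} [TopologicalSpace N] [ChartedSpace B N]

/-- The points at which the natural coordinates at `m₀` and `pr m₀` are available. -/
def adaptedNhd (pr : C^∞⟮𝓘(ℝ, E), M; 𝓘(ℝ, B), N⟯) (m₀ : M) : Set M :=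
  (chartAt E m₀).source ∩ pr ⁻¹' (chartAt B (pr m₀)).source

theorem isOpen_adaptedNhd (pr : C^∞⟮𝓘(ℝ, E), M; 𝓘(ℝ, B), N⟯) (m₀ : M) :
    IsOpen (adaptedNhd pr m₀) :=
  (chartAt E m₀).open_source.inter
    ((chartAt B (pr m₀)).open_source.preimage pr.contMDiff.continuous)

theorem mem_adaptedNhd_self (pr : C^∞⟮𝓘(ℝ, E), M; 𝓘(ℝ, B), N⟯) (m₀ : M) :
    m₀ ∈ adaptedNhd pr m₀ :=
  ⟨mem_chart_source E m₀, mem_chart_source B (pr m₀)⟩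

/-- The derivative of the projection at `m`, read in the preferred charts at `m` and `pr m`. -/
def baseDeriv (pr : C^∞⟮𝓘(ℝ, E), M; 𝓘(ℝ, B), N⟯) (m : M) : E →L[ℝ] B :=
  mfderiv 𝓘(ℝ, E) 𝓘(ℝ, B) pr m

/-- A fibre bundle is a submersion: a local section through `m` inverts the derivative. -/
theorem IsFibreBundle.surjective_baseDeriv {C : Type*} [NormedAddCommGroup C] [NormedSpace ℝ C]
    {P : Type*} [TopologicalSpace P] [ChartedSpace C P] {pr : C^∞⟮𝓘(ℝ, E), M; 𝓘(ℝ, B), N⟯}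
    (hpr : IsFibreBundle C P pr) (m : M) : Function.Surjective (baseDeriv pr m) := by
  obtain ⟨e, hm, -, he⟩ := hpr (pr m)
  let s : N → M := fun n => e.toOpenPartialHomeomorph.symm (n, (e m).2)
  have hmem : (pr m, (e m).2) ∈ e.target := by
    rw [e.mem_target]
    exact hm
  have hs : ContMDiffAt 𝓘(ℝ, B) 𝓘(ℝ, E) ∞ s (pr m) :=
    ((he.contMDiffAt (e.open_target.mem_nhds hmem))).comp (pr m)
      (contMDiffAt_id.prodMk contMDiffAt_const)
  have hsm : s (pr m) = m := by
    have h1 : e m = (pr m, (e m).2) := Prod.ext (e.coe_fst' hm) rfl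
    change e.toOpenPartialHomeomorph.symm (pr m, (e m).2) = m
    rw [← h1]
    exact e.toOpenPartialHomeomorph.left_inv (e.mem_source.2 hm)
  have hprs : (fun n => pr (s n)) =ᶠ[nhds (pr m)] id := by
    filter_upwards [e.open_baseSet.mem_nhds hm] with n hn
    exact e.proj_symm_apply' hn
  let D : B →L[ℝ] E := mfderiv 𝓘(ℝ, B) 𝓘(ℝ, E) s (pr m)
  have hds : HasMFDerivAt 𝓘(ℝ, B) 𝓘(ℝ, E) s (pr m) D :=
    (hs.mdifferentiableAt (by simp)).hasMFDerivAt
  have hdpr : HasMFDerivAt 𝓘(ℝ, E) 𝓘(ℝ, B) pr (s (pr m))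
      (baseDeriv (E := E) (B := B) pr (s (pr m))) :=
    (pr.mdifferentiableAt).hasMFDerivAt
  have hcomp := hdpr.comp (pr m) hds
  have hid := (hasMFDerivAt_id (I := 𝓘(ℝ, B)) (pr m)).congr_of_eventuallyEq hprs
  have heq : ∀ b : B, (baseDeriv (E := E) (B := B) pr (s (pr m)) (D b) : B) = b :=
    fun b => congrArg (fun L : B →L[ℝ] B => L b) (hasMFDerivAt_unique hcomp hid)
  rw [hsm] at heq
  exact fun b => ⟨_, heq b⟩

variable [IsManifold 𝓘(ℝ, E) ∞ M] [IsManifold 𝓘(ℝ, B) ∞ N]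

/-- The derivative of the projection in natural coordinates over the preferred charts at `m₀` and
`pr m₀`, as a function of the coordinates of the point. -/
def locDeriv (pr : C^∞⟮𝓘(ℝ, E), M; 𝓘(ℝ, B), N⟯) (m₀ : M) (q : E) : E →L[ℝ] B :=
  (fibreTriv (pr m₀) (pr ((extChartAt 𝓘(ℝ, E) m₀).symm q))).comp
    ((baseDeriv pr ((extChartAt 𝓘(ℝ, E) m₀).symm q)).comp
      (fibreTrivSymm m₀ ((extChartAt 𝓘(ℝ, E) m₀).symm q)))

variable {pr : C^∞⟮𝓘(ℝ, E), M; 𝓘(ℝ, B), N⟯} {m₀ : M}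

theorem locDeriv_coord {m : M} (hm : m ∈ adaptedNhd pr m₀) (w : E) :
    locDeriv pr m₀ (extChartAt 𝓘(ℝ, E) m₀ m) (fibreTriv m₀ m w) =
      fibreTriv (pr m₀) (pr m) (baseDeriv pr m w) := by
  have h : (extChartAt 𝓘(ℝ, E) m₀).symm (extChartAt 𝓘(ℝ, E) m₀ m) = m :=
    (extChartAt 𝓘(ℝ, E) m₀).left_inv (by rw [extChartAt_source]; exact hm.1)
  simp only [locDeriv, ContinuousLinearMap.comp_apply, h]
  rw [fibreTrivSymm_fibreTriv hm.1]

theorem locDeriv_self (w : E) :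
    locDeriv pr m₀ (extChartAt 𝓘(ℝ, E) m₀ m₀) w = baseDeriv pr m₀ w := by
  have h := locDeriv_coord (mem_adaptedNhd_self pr m₀) w
  rwa [fibreTriv_self, fibreTriv_self] at h

/-- Evaluated on a vector, `locDeriv` is the fibre part of the tangent map of the projection along a
section that is constant in coordinates. -/
theorem contDiffAt_locDeriv [FiniteDimensional ℝ E] {m : M} (hm : m ∈ adaptedNhd pr m₀) :
    ContDiffAt ℝ ∞ (locDeriv pr m₀) (extChartAt 𝓘(ℝ, E) m₀ m) := by
  refine contDiffAt_of_clm_apply fun w => ?_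
  have hsrc : m ∈ (extChartAt 𝓘(ℝ, E) m₀).source := by rw [extChartAt_source]; exact hm.1
  have hinv : (extChartAt 𝓘(ℝ, E) m₀).symm (extChartAt 𝓘(ℝ, E) m₀ m) = m :=
    (extChartAt 𝓘(ℝ, E) m₀).left_inv hsrc
  have h1 : ContMDiffAt 𝓘(ℝ, E) 𝓘(ℝ, E).tangent ∞ (fun q : E => natPoint m₀ (q, w))
      (extChartAt 𝓘(ℝ, E) m₀ m) :=
    ContMDiffAt.comp (extChartAt 𝓘(ℝ, E) m₀ m) (g := natPoint m₀)
      (contMDiffAt_natPoint ((extChartAt 𝓘(ℝ, E) m₀).map_source hsrc))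
      (contDiff_id.prodMk contDiff_const).contMDiff.contMDiffAt
  have h2 : ContMDiff 𝓘(ℝ, E).tangent 𝓘(ℝ, B).tangent ∞ (tangentMap 𝓘(ℝ, E) 𝓘(ℝ, B) pr) :=
    pr.contMDiff.contMDiff_tangentMap le_rfl
  have h3 := h2.contMDiffAt.comp (extChartAt 𝓘(ℝ, E) m₀ m) h1
  have h4 := (contMDiffAt_fibreTriv (m₀ := pr m₀)
    (u := tangentMap 𝓘(ℝ, E) 𝓘(ℝ, B) pr (natPoint m₀ (extChartAt 𝓘(ℝ, E) m₀ m, w)))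
    (by
      change pr ((extChartAt 𝓘(ℝ, E) m₀).symm (extChartAt 𝓘(ℝ, E) m₀ m)) ∈ _
      rw [hinv]
      exact hm.2)).comp (extChartAt 𝓘(ℝ, E) m₀ m) h3
  exact contMDiffAt_iff_contDiffAt.1 h4

/-- Every vertical tangent vector is the value of a smooth vertical vector field. With `R(q)` a
smooth right inverse of the coordinate expression `A(q)` of the derivative of the projection, the
field with components `w - R(q) A(q) w` is vertical near `m₀`; a bump function makes it global. -/
theorem exists_isVerticalVF [FiniteDimensional ℝ E] [FiniteDimensional ℝ B] [T2Space M]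
    (pr : C^∞⟮𝓘(ℝ, E), M; 𝓘(ℝ, B), N⟯) (m₀ : M)
    (hsurj : Function.Surjective (baseDeriv pr m₀)) (w : E) (hw : baseDeriv pr m₀ w = 0) :
    ∃ Y : (m : M) → TangentSpace 𝓘(ℝ, E) m, IsVerticalVF pr Y ∧ Y m₀ = w := by
  set φ := extChartAt 𝓘(ℝ, E) m₀ with hφ
  obtain ⟨s, hs⟩ := (baseDeriv pr m₀ : E →ₗ[ℝ] B).exists_rightInverse_of_surjective
    (LinearMap.range_eq_top.2 hsurj)
  let R₀ : B →L[ℝ] E := LinearMap.toContinuousLinearMap s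
  have hR₀ : (baseDeriv pr m₀).comp R₀ = ContinuousLinearMap.id ℝ B :=
    ContinuousLinearMap.ext fun b => LinearMap.congr_fun hs b
  let A := locDeriv pr m₀
  have hA₀ : A (φ m₀) = baseDeriv pr m₀ := ContinuousLinearMap.ext locDeriv_self
  let K : M → B →L[ℝ] B := fun m => (A (φ m)).comp R₀
  let O : Set M := adaptedNhd pr m₀ ∩ K ⁻¹' {L | IsUnit L}
  have hsrc : ∀ m ∈ adaptedNhd pr m₀, m ∈ φ.source := fun m hm => by
    rw [hφ, extChartAt_source]
    exact hm.1
  have hφs : ∀ m ∈ adaptedNhd pr m₀, ContMDiffAt 𝓘(ℝ, E) 𝓘(ℝ, E) ∞ φ m := fun m hm =>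
    contMDiffAt_extChartAt' hm.1
  have hAs : ∀ m ∈ adaptedNhd pr m₀, ContMDiffAt 𝓘(ℝ, E) 𝓘(ℝ, E →L[ℝ] B) ∞ (fun m => A (φ m)) m :=
    fun m hm => (contDiffAt_locDeriv hm).contMDiffAt.comp m (hφs m hm)
  have hKs : ∀ m ∈ adaptedNhd pr m₀, ContMDiffAt 𝓘(ℝ, E) 𝓘(ℝ, B →L[ℝ] B) ∞ K m :=
    fun m hm => (hAs m hm).clm_comp contMDiffAt_const
  have hO : IsOpen O := ContinuousOn.isOpen_inter_preimage
    (fun m hm => (hKs m hm).continuousAt.continuousWithinAt) (isOpen_adaptedNhd pr m₀) Units.isOpen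
  have hm₀ : m₀ ∈ O := by
    refine ⟨mem_adaptedNhd_self pr m₀, ?_⟩
    change IsUnit ((A (φ m₀)).comp R₀)
    rw [hA₀, hR₀]
    exact isUnit_one
  let k : M → E := fun m => w - R₀ (Ring.inverse (K m) (A (φ m) w))
  have hks : ∀ m ∈ O, ContMDiffAt 𝓘(ℝ, E) 𝓘(ℝ, E) ∞ k m := fun m hm => by
    obtain ⟨x, hx⟩ : IsUnit (K m) := hm.2
    have h1 : ContMDiffAt 𝓘(ℝ, E) 𝓘(ℝ, B →L[ℝ] B) ∞ (fun m => Ring.inverse (K m)) m :=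
      ContMDiffAt.comp m (g := Ring.inverse) (hx ▸ (contDiffAt_ringInverse ℝ x)).contMDiffAt
        (hKs m hm.1)
    have h2 := h1.clm_apply ((hAs m hm.1).clm_apply (contMDiffAt_const (c := w)))
    exact contMDiffAt_const.sub ((contMDiffAt_const (c := R₀)).clm_apply h2)
  have hkA : ∀ m ∈ O, A (φ m) (k m) = 0 := fun m hm => by
    have h1 : (K m) * Ring.inverse (K m) = 1 := Ring.mul_inverse_cancel _ hm.2
    have h2 := congrArg (fun L : B →L[ℝ] B => L (A (φ m) w)) h1
    change A (φ m) (w - R₀ (Ring.inverse (K m) (A (φ m) w))) = 0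
    rw [map_sub, sub_eq_zero]
    exact h2.symm
  obtain ⟨ψ, -, hψ⟩ := (SmoothBumpFunction.nhds_basis_tsupport (I := 𝓘(ℝ, E)) m₀).mem_iff.1
    (hO.mem_nhds hm₀)
  let y : M → E := fun m => ψ m • fibreTrivSymm m₀ m (k m)
  have hy : ∀ m ∈ adaptedNhd pr m₀, fibreTriv m₀ m (y m) = ψ m • k m := fun m hm => by
    change fibreTriv m₀ m (ψ m • fibreTrivSymm m₀ m (k m)) = _
    rw [map_smul, fibreTriv_fibreTrivSymm hm.1]
  refine ⟨fun m => y m, ⟨fun m => ?_, fun m => ?_⟩, ?_⟩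
  · by_cases hm : m ∈ tsupport ψ
    · refine ((trivializationAt E (TangentSpace 𝓘(ℝ, E)) m₀).contMDiffAt_iff ?_).2
        ⟨contMDiffAt_id, ?_⟩
      · rw [Trivialization.mem_source]
        exact (hψ hm).1.1
      · refine ((ψ.contMDiff m).smul (hks m (hψ hm))).congr_of_eventuallyEq ?_
        filter_upwards [hO.mem_nhds (hψ hm)] with m' hm'
        exact (fibreTriv_apply hm'.1.1 (y m')).symm.trans (hy m' hm'.1)
    · have h0 : ∀ᶠ m' in nhds m, y m' = 0 := by
        filter_upwards [(isClosed_tsupport ψ).isOpen_compl.mem_nhds hm] with m' hm'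
        change ψ m' • _ = (0 : E)
        rw [image_eq_zero_of_notMem_tsupport hm', zero_smul]
      have hz : ContMDiffAt 𝓘(ℝ, E) 𝓘(ℝ, E).tangent ∞
          (fun m => (⟨m, (0 : E)⟩ : TangentBundle 𝓘(ℝ, E) M)) m :=
        (Bundle.contMDiff_zeroSection ℝ (TangentSpace 𝓘(ℝ, E) : M → Type _)).contMDiffAt
      refine hz.congr_of_eventuallyEq ?_
      filter_upwards [h0] with m' hm'
      rw [hm']
  · by_cases hm : m ∈ tsupport ψ
    · have hmO := hψ hm
      have h1 := locDeriv_coord hmO.1 (y m)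
      rw [hy m hmO.1, map_smul, hkA m hmO, smul_zero] at h1
      have h2 := fibreTrivSymm_fibreTriv hmO.1.2 (baseDeriv pr m (y m))
      rw [← h1, map_zero] at h2
      exact h2.symm
    · have : y m = 0 := by
        change ψ m • _ = (0 : E)
        rw [image_eq_zero_of_notMem_tsupport hm, zero_smul]
      exact (congrArg (baseDeriv pr m) this).trans (map_zero _)
  · have h1 := fibreTrivSymm_fibreTriv (mem_chart_source E m₀) (y m₀)
    have h2 : k m₀ = w := by
      change w - R₀ (Ring.inverse (K m₀) (A (φ m₀) w)) = w
      rw [hA₀, hw, map_zero, map_zero, sub_zero]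
    have h3 := hy m₀ (mem_adaptedNhd_self pr m₀)
    rw [fibreTriv_self, ψ.eq_one, one_smul, h2] at h3
    exact h3

end Submersion

/-! ### Finsler energies in natural coordinates -/

section FinslerEnergy

variable {E : Type*} [NormedAddCommGroup E] [NormedSpace ℝ E]
  {M : Type*} [TopologicalSpace M] [ChartedSpace E M] [IsManifold 𝓘(ℝ, E) ∞ M]

/-- The restriction of the energy to the tangent space at `m`. -/
def fibreEnergy (F : TangentBundle 𝓘(ℝ, E) M → ℝ) (m : M) (w : E) : ℝ :=
  energy F (fibreIncl m w)

/-- The energy in natural coordinates over the preferred chart at `m₀`. -/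
def locEnergy (F : TangentBundle 𝓘(ℝ, E) M → ℝ) (m₀ : M) (x : E × E) : ℝ :=
  energy F (natPoint m₀ x)

variable {F : TangentBundle 𝓘(ℝ, E) M → ℝ}

theorem IsFinsler.contMDiffAt_energy (hF : IsFinsler F) {u : TangentBundle 𝓘(ℝ, E) M}
    (hu : u ∈ slit E M) : ContMDiffAt 𝓘(ℝ, E).tangent 𝓘(ℝ, ℝ) ∞ (energy F) u := by
  have h1 : ContMDiffAt 𝓘(ℝ, E).tangent 𝓘(ℝ, ℝ) ∞ F u :=
    hF.smooth.contMDiffAt (isOpen_slit.mem_nhds hu)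
  have h2 : ContDiff ℝ ∞ fun x : ℝ => x ^ 2 / 2 := by fun_prop
  exact h2.contMDiff.contMDiffAt.comp u h1

theorem IsFinsler.isMinkowskiEnergy (hF : IsFinsler F) (m : M) :
    IsMinkowskiEnergy (fibreEnergy F m) where
  continuous := ((hF.continuous.comp (contMDiff_fibreIncl m).continuous).pow 2).div_const 2
  smooth u hu := contMDiffAt_iff_contDiffAt.1 <|
    (hF.contMDiffAt_energy (u := fibreIncl m u) hu).comp u (contMDiff_fibreIncl m).contMDiffAt
  homogeneous c u hc := by
    have h : F (fibreIncl m (c • u)) = c * F (fibreIncl m u) := hF.homogeneous c (fibreIncl m u) hc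
    simp only [fibreEnergy, energy, h]
    ring
  convex u w hu hw := hF.strongly_convex m u w hu hw

/-- The energy attains its minimum on the zero section, so its derivative vanishes there. By
homogeneity it is in fact differentiable there, but Fermat's argument does not require this: if
it were not, `mfderiv` would be zero by convention. -/
theorem IsFinsler.mfderiv_energy_zero (hF : IsFinsler F) (m : M)
    (z : TangentSpace 𝓘(ℝ, E).tangent (fibreIncl m (0 : E))) :
    mfderiv 𝓘(ℝ, E).tangent 𝓘(ℝ, ℝ) (energy F) (fibreIncl m (0 : E)) z = (0 : ℝ) := by
  by_cases hd : MDifferentiableAt 𝓘(ℝ, E).tangent 𝓘(ℝ, ℝ) (energy F) (fibreIncl m (0 : E))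
  · let L : E × E →L[ℝ] ℝ :=
      mfderiv 𝓘(ℝ, E).tangent 𝓘(ℝ, ℝ) (energy F) (fibreIncl m (0 : E))
    have h : HasFDerivWithinAt
        (writtenInExtChartAt 𝓘(ℝ, E).tangent 𝓘(ℝ, ℝ) (fibreIncl m (0 : E)) (energy F)) L
        (range 𝓘(ℝ, E).tangent)
        (extChartAt 𝓘(ℝ, E).tangent (fibreIncl m (0 : E)) (fibreIncl m (0 : E))) :=
      hd.hasMFDerivAt.2
    have hr : range 𝓘(ℝ, E).tangent = univ := 𝓘(ℝ, E).tangent.range_eq_univ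
    rw [hr, hasFDerivWithinAt_univ] at h
    refine congrArg (fun L : E × E →L[ℝ] ℝ => L z) (IsLocalMin.hasFDerivAt_eq_zero ?_ h)
    refine Filter.Eventually.of_forall fun x => ?_
    have h0 : writtenInExtChartAt 𝓘(ℝ, E).tangent 𝓘(ℝ, ℝ) (fibreIncl m (0 : E)) (energy F)
        (extChartAt 𝓘(ℝ, E).tangent (fibreIncl m (0 : E)) (fibreIncl m (0 : E))) = 0 := by
      change energy F ((extChartAt 𝓘(ℝ, E).tangent (fibreIncl m (0 : E))).symm
        (extChartAt 𝓘(ℝ, E).tangent (fibreIncl m (0 : E)) (fibreIncl m (0 : E)))) = 0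
      rw [extChartAt_to_inv]
      exact (hF.isMinkowskiEnergy m).apply_zero
    rw [h0]
    exact div_nonneg (sq_nonneg _) two_pos.le
  · rw [mfderiv_zero_of_not_mdifferentiableAt hd]
    rfl

/-- The vertical lift differentiates along the fibres. -/
theorem IsFinsler.act_vLift (hF : IsFinsler F) (Y : (m : M) → TangentSpace 𝓘(ℝ, E) m) (m : M)
    (u : E) : act (vLift Y) (energy F) (fibreIncl m u) = fderiv ℝ (fibreEnergy F m) u (Y m) := by
  by_cases hu : u = 0
  · subst hu
    rw [(hF.isMinkowskiEnergy m).fderiv_zero]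
    exact hF.mfderiv_energy_zero m _
  · let L : E × E →L[ℝ] ℝ := mfderiv 𝓘(ℝ, E).tangent 𝓘(ℝ, ℝ) (energy F) (fibreIncl m u)
    have h1 : HasMFDerivAt 𝓘(ℝ, E).tangent 𝓘(ℝ, ℝ) (energy F) (fibreIncl m u) L :=
      ((hF.contMDiffAt_energy (u := fibreIncl m u) hu).mdifferentiableAt (by simp)).hasMFDerivAt
    have h2 : HasFDerivAt (fibreEnergy F m) (L.comp (ContinuousLinearMap.inr ℝ E E)) u :=
      (HasMFDerivAt.comp u h1 (hasMFDerivAt_fibreIncl m u)).hasFDerivAt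
    rw [h2.fderiv]
    unfold act
    rw [vLift_eq]
    rfl

theorem IsFinsler.contDiffAt_locEnergy (hF : IsFinsler F) {m₀ m : M}
    (hm : m ∈ (chartAt E m₀).source) {u : E} (hu : u ≠ 0) :
    ContDiffAt ℝ ∞ (locEnergy F m₀) (extChartAt 𝓘(ℝ, E) m₀ m, u) := by
  have hsrc : m ∈ (extChartAt 𝓘(ℝ, E) m₀).source := by rwa [extChartAt_source]
  refine contMDiffAt_iff_contDiffAt.1 (ContMDiffAt.comp _ (g := energy F) ?_
    (contMDiffAt_natPoint ((extChartAt 𝓘(ℝ, E) m₀).map_source hsrc)))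
  refine hF.contMDiffAt_energy ?_
  rw [← fibreTriv_fibreTrivSymm hm u, natPoint_coord hm]
  intro h0
  have h0' : fibreTrivSymm m₀ m u = 0 := h0
  apply hu
  rw [← fibreTriv_fibreTrivSymm hm u, h0', map_zero]

theorem fibreEnergy_eq_locEnergy {m₀ m : M} (hm : m ∈ (chartAt E m₀).source) (w : E) :
    fibreEnergy F m w = locEnergy F m₀ (extChartAt 𝓘(ℝ, E) m₀ m, fibreTriv m₀ m w) := by
  rw [locEnergy, natPoint_coord hm, fibreEnergy]

theorem fibreTriv_ne_zero {m₀ m : M} (hm : m ∈ (chartAt E m₀).source) {u : E} (hu : u ≠ 0) :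
    fibreTriv m₀ m u ≠ 0 := fun h => hu <| by
  rw [← fibreTrivSymm_fibreTriv hm u, h, map_zero]

theorem IsFinsler.fderiv_fibreEnergy (hF : IsFinsler F) {m₀ m : M}
    (hm : m ∈ (chartAt E m₀).source) {u : E} (hu : u ≠ 0) (w : E) :
    fderiv ℝ (fibreEnergy F m) u w =
      fderiv ℝ (locEnergy F m₀) (extChartAt 𝓘(ℝ, E) m₀ m, fibreTriv m₀ m u)
        (0, fibreTriv m₀ m w) := by
  have h1 := ((hF.contDiffAt_locEnergy hm (fibreTriv_ne_zero hm hu)).differentiableAt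
    (by simp)).hasFDerivAt
  have h2 : HasFDerivAt (fun w : E => (extChartAt 𝓘(ℝ, E) m₀ m, fibreTriv m₀ m w))
      ((0 : E →L[ℝ] E).prod (fibreTriv m₀ m)) u :=
    (hasFDerivAt_const _ _).prodMk (fibreTriv m₀ m).hasFDerivAt
  have h3 : fibreEnergy F m =
      locEnergy F m₀ ∘ fun w : E => (extChartAt 𝓘(ℝ, E) m₀ m, fibreTriv m₀ m w) :=
    funext (fibreEnergy_eq_locEnergy hm)
  rw [h3, (h1.comp u h2).fderiv]
  rfl

theorem IsFinsler.hessian_locEnergy (hF : IsFinsler F) (m₀ : M) {u : E} (hu : u ≠ 0) (w : E) :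
    fderiv ℝ (fderiv ℝ (locEnergy F m₀)) (extChartAt 𝓘(ℝ, E) m₀ m₀, u) (0, w) (0, w) =
      fderiv ℝ (fderiv ℝ (fibreEnergy F m₀)) u w w := by
  have hc : ContinuousAt (fun t : ℝ => u + t • w) 0 := by fun_prop
  have h1 : HasDerivAt (fun t : ℝ => u + t • w) w 0 := by
    simpa using ((hasDerivAt_id (0 : ℝ)).smul_const w).const_add u
  have h2 : HasDerivAt (fun t : ℝ => (extChartAt 𝓘(ℝ, E) m₀ m₀, u + t • w)) ((0, w) : E × E) 0 :=
    (hasDerivAt_const (0 : ℝ) _).prodMk h1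
  have h3 : HasDerivAt (fun t : ℝ => fderiv ℝ (fibreEnergy F m₀) (u + t • w))
      (fderiv ℝ (fderiv ℝ (fibreEnergy F m₀)) u w) 0 := by
    have h : ContDiffAt ℝ ∞ (fderiv ℝ (fibreEnergy F m₀)) u :=
      ((hF.isMinkowskiEnergy m₀).smooth u hu).fderiv_right le_rfl
    have h' : HasFDerivAt (fderiv ℝ (fibreEnergy F m₀))
        (fderiv ℝ (fderiv ℝ (fibreEnergy F m₀)) u) (u + (0 : ℝ) • w) := by
      simpa only [zero_smul, add_zero] using (h.differentiableAt (by simp)).hasFDerivAt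
    exact h'.comp_hasDerivAt (0 : ℝ) h1
  have h4 : HasDerivAt
      (fun t : ℝ => fderiv ℝ (locEnergy F m₀) (extChartAt 𝓘(ℝ, E) m₀ m₀, u + t • w))
      (fderiv ℝ (fderiv ℝ (locEnergy F m₀)) (extChartAt 𝓘(ℝ, E) m₀ m₀, u) (0, w)) 0 := by
    have h : ContDiffAt ℝ ∞ (fderiv ℝ (locEnergy F m₀)) (extChartAt 𝓘(ℝ, E) m₀ m₀, u) :=
      (hF.contDiffAt_locEnergy (mem_chart_source E m₀) hu).fderiv_right le_rfl
    have h' : HasFDerivAt (fderiv ℝ (locEnergy F m₀))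
        (fderiv ℝ (fderiv ℝ (locEnergy F m₀)) (extChartAt 𝓘(ℝ, E) m₀ m₀, u))
        (extChartAt 𝓘(ℝ, E) m₀ m₀, u + (0 : ℝ) • w) := by
      simpa only [zero_smul, add_zero] using (h.differentiableAt (by simp)).hasFDerivAt
    exact h'.comp_hasDerivAt (0 : ℝ) h2
  have h5 := h3.clm_apply (hasDerivAt_const (0 : ℝ) w)
  have h6 := h4.clm_apply (hasDerivAt_const (0 : ℝ) ((0, w) : E × E))
  rw [ContinuousLinearMap.map_zero, add_zero] at h5 h6
  refine h6.unique (h5.congr_of_eventuallyEq ?_)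
  filter_upwards [hc.eventually_ne (by simpa using hu)] with t ht
  rw [hF.fderiv_fibreEnergy (mem_chart_source E m₀) ht, fibreTriv_self, fibreTriv_self]

/-- In natural coordinates `Yᵛ(E)` is `∂E/∂u` applied to the components of `Y`, hence smooth. -/
theorem IsFinsler.contMDiffAt_act_vLift (hF : IsFinsler F)
    {Y : (m : M) → TangentSpace 𝓘(ℝ, E) m} (hY : IsSmoothVF Y) {u₀ : TangentBundle 𝓘(ℝ, E) M}
    (hu₀ : u₀ ∈ slit E M) :
    ContMDiffAt 𝓘(ℝ, E).tangent 𝓘(ℝ, ℝ) ∞ (act (vLift Y) (energy F)) u₀ := by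
  have hm₀ := mem_chart_source E u₀.1
  have hp : ContMDiffAt 𝓘(ℝ, E).tangent 𝓘(ℝ, E) ∞
      (fun u : TangentBundle 𝓘(ℝ, E) M => u.1) u₀ :=
    contMDiffAt_proj (TangentSpace 𝓘(ℝ, E))
  have h1 : ContMDiffAt 𝓘(ℝ, E).tangent 𝓘(ℝ, E × E) ∞ (fun u : TangentBundle 𝓘(ℝ, E) M =>
      (extChartAt 𝓘(ℝ, E) u₀.1 u.1, fibreTriv u₀.1 u.1 u.2)) u₀ :=
    (contMDiffAt_extChartAt.comp u₀ hp).prodMk_space (contMDiffAt_fibreTriv hm₀)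
  have h2 : ContMDiffAt 𝓘(ℝ, E).tangent 𝓘(ℝ, E) ∞
      (fun u : TangentBundle 𝓘(ℝ, E) M => (fibreTriv u₀.1 u.1 (Y u.1) : E)) u₀ :=
    ContMDiffAt.comp u₀ (contMDiffAt_fibreTriv (u := ⟨u₀.1, Y u₀.1⟩) hm₀)
      ((hY u₀.1).comp u₀ hp)
  have h3 : ContDiffAt ℝ ∞ (fderiv ℝ (locEnergy F u₀.1))
      (extChartAt 𝓘(ℝ, E) u₀.1 u₀.1, fibreTriv u₀.1 u₀.1 u₀.2) :=
    (hF.contDiffAt_locEnergy hm₀ (fibreTriv_ne_zero hm₀ hu₀)).fderiv_right le_rfl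
  have h4 := (h3.contMDiffAt.comp u₀ h1).clm_apply
    ((contMDiffAt_const (c := (0 : E))).prodMk_space h2)
  refine h4.congr_of_eventuallyEq ?_
  filter_upwards [hp.continuousAt.eventually ((chartAt E u₀.1).open_source.mem_nhds hm₀),
    isOpen_slit.mem_nhds hu₀] with u hu hu0
  exact (hF.act_vLift Y u.1 u.2).trans (hF.fderiv_fibreEnergy hu hu0 (Y u.1))

/-- The derivative of `Yᵛ(E)` along a vertical vector is a value of the Hessian. -/
theorem IsFinsler.mfderiv_act_vLift (hF : IsFinsler F)
    {Y : (m : M) → TangentSpace 𝓘(ℝ, E) m} (hY : IsSmoothVF Y) (m : M) {u : E} (hu : u ≠ 0)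
    (w : E) :
    mfderiv 𝓘(ℝ, E).tangent 𝓘(ℝ, ℝ) (act (vLift Y) (energy F)) (fibreIncl m u)
      ((0, w) : E × E) = fderiv ℝ (fderiv ℝ (fibreEnergy F m)) u w (Y m) := by
  let L : E × E →L[ℝ] ℝ :=
    mfderiv 𝓘(ℝ, E).tangent 𝓘(ℝ, ℝ) (act (vLift Y) (energy F)) (fibreIncl m u)
  have h1 : HasMFDerivAt 𝓘(ℝ, E).tangent 𝓘(ℝ, ℝ) (act (vLift Y) (energy F)) (fibreIncl m u) L :=
    ((hF.contMDiffAt_act_vLift hY (u₀ := fibreIncl m u) hu).mdifferentiableAt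
      (by simp)).hasMFDerivAt
  have h2 : HasFDerivAt (act (vLift Y) (energy F) ∘ fibreIncl m)
      (L.comp (ContinuousLinearMap.inr ℝ E E)) u :=
    (HasMFDerivAt.comp u h1 (hasMFDerivAt_fibreIncl m u)).hasFDerivAt
  let y : E := Y m
  have h3 : act (vLift Y) (energy F) ∘ fibreIncl m =
      fun u => fderiv ℝ (fibreEnergy F m) u y := funext fun u => hF.act_vLift Y m u
  have h4 : ContDiffAt ℝ ∞ (fderiv ℝ (fibreEnergy F m)) u :=
    ((hF.isMinkowskiEnergy m).smooth u hu).fderiv_right le_rfl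
  have h5 : HasFDerivAt (fun u => fderiv ℝ (fibreEnergy F m) u y)
      ((ContinuousLinearMap.apply ℝ ℝ y).comp (fderiv ℝ (fderiv ℝ (fibreEnergy F m)) u))
      u :=
    (ContinuousLinearMap.apply ℝ ℝ y).hasFDerivAt.comp u
      (h4.differentiableAt (by simp)).hasFDerivAt
  rw [h3] at h2
  exact congrArg (fun L : E →L[ℝ] ℝ => L w) (h2.unique h5)

end FinslerEnergy

/-! ### The induced splitting -/

section InducedSplitting

variable {E : Type*} [NormedAddCommGroup E] [NormedSpace ℝ E]
  {M : Type*} [TopologicalSpace M] [ChartedSpace E M]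
  {B : Type*} [NormedAddCommGroup B] [NormedSpace ℝ B]
  {N : Type*} [TopologicalSpace N] [ChartedSpace B N]
  {pr : C^∞⟮𝓘(ℝ, E), M; 𝓘(ℝ, B), N⟯}

theorem tangentMap_fibreIncl (m : M) (u : E) : tangentMap 𝓘(ℝ, E) 𝓘(ℝ, B) pr (fibreIncl m u) =
    fibreIncl (pr m) (baseDeriv pr m u) := rfl

theorem contMDiffAt_pull_fibreTriv [IsManifold 𝓘(ℝ, B) ∞ N] (p₀ : PullTN pr) :
    ContMDiffAt (𝓘(ℝ, E).prod 𝓘(ℝ, B)) 𝓘(ℝ, B) ∞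
      (fun p : PullTN pr => (fibreTriv (pr p₀.1) (pr p.1) p.2 : B)) p₀ := by
  have h := (Bundle.contMDiffAt_totalSpace (n := ∞) (IB := 𝓘(ℝ, E)) (IM := 𝓘(ℝ, E).prod 𝓘(ℝ, B))
    (f := fun p : PullTN pr => p) (x₀ := p₀)).1 contMDiffAt_id
  refine h.2.congr_of_eventuallyEq ?_
  filter_upwards [h.1.continuousAt.eventually
    ((isOpen_adaptedNhd pr p₀.1).mem_nhds (mem_adaptedNhd_self pr p₀.1))] with p hp
  exact fibreTriv_apply hp.2 p.2

variable [IsManifold 𝓘(ℝ, E) ∞ M] {F : TangentBundle 𝓘(ℝ, E) M → ℝ}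

/-- The tangent vector `u` at `m` lies over `v` and is a critical point of the energy on the affine
subspace of all vectors over `v`. -/
def IsCriticalLift (pr : C^∞⟮𝓘(ℝ, E), M; 𝓘(ℝ, B), N⟯) (F : TangentBundle 𝓘(ℝ, E) M → ℝ) (m : M)
    (v : B) (u : E) : Prop :=
  baseDeriv pr m u = v ∧ ∀ w, baseDeriv pr m w = 0 → fderiv ℝ (fibreEnergy F m) u w = 0

theorem IsFinsler.exists_isCriticalLift [FiniteDimensional ℝ E] (hF : IsFinsler F) {m : M}
    (hsurj : Function.Surjective (baseDeriv pr m)) (v : B) : ∃ u, IsCriticalLift pr F m v u :=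
  (hF.isMinkowskiEnergy m).exists_critical _ hsurj v

theorem IsFinsler.isCriticalLift_unique (hF : IsFinsler F) {m : M} {v : B} {u₁ u₂ : E}
    (h₁ : IsCriticalLift pr F m v u₁) (h₂ : IsCriticalLift pr F m v u₂) : u₁ = u₂ :=
  (hF.isMinkowskiEnergy m).critical_unique _ (h₁.1.trans h₂.1.symm) h₁.2 h₂.2

theorem fibreIncl_injective (m : M) : Function.Injective (fibreIncl (E := E) m) := fun u w h => by
  have := congrArg (fun x : TangentBundle 𝓘(ℝ, E) M =>
    (trivializationAt E (TangentSpace 𝓘(ℝ, E)) m x).2) h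
  simpa only [trivializationAt_fibreIncl_self] using this

theorem IsFinsler.isHomogeneous_induced (hF : IsFinsler F)
    {h : PullTN pr → TangentBundle 𝓘(ℝ, E) M} {r : PullTN pr → E}
    (hr : ∀ p, h p = fibreIncl p.1 (r p))
    (hc : ∀ p : PullTN pr, IsCriticalLift pr F p.1 p.2 (r p)) : IsHomogeneous pr h := by
  intro c hc0 p
  have hcrit : IsCriticalLift pr F p.1 (c • p.2 : B) (c • r p) := by
    refine ⟨(map_smul _ c (r p)).trans (congrArg (c • ·) (hc p).1), fun w hw => ?_⟩
    rw [(hF.isMinkowskiEnergy p.1).fderiv_smul hc0, (hc p).2 w hw, mul_zero]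
  have h1 : r (pullScale pr c p) = c • r p := hF.isCriticalLift_unique (hc _) hcrit
  rw [hr, hr, h1]
  rfl

variable [IsManifold 𝓘(ℝ, B) ∞ N]

/-- Since every vertical vector extends to a vertical vector field, the conditions on the induced
splitting are pointwise conditions on its fibre part. -/
theorem IsFinsler.isInduced_iff [FiniteDimensional ℝ E] [FiniteDimensional ℝ B] [T2Space M]
    (hF : IsFinsler F) (hsurj : ∀ m, Function.Surjective (baseDeriv pr m))
    {h : PullTN pr → TangentBundle 𝓘(ℝ, E) M} :
    IsInduced pr F h ↔ ∃ r : PullTN pr → E, (∀ p, h p = fibreIncl p.1 (r p)) ∧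
      ∀ p : PullTN pr, IsCriticalLift pr F p.1 p.2 (r p) := by
  constructor
  · intro hi
    have hex : ∀ p, ∃ r : E, h p = fibreIncl p.1 r := fun p => by
      rw [← hi.fibre_preserving p]
      exact ⟨(h p).2, rfl⟩
    choose r hr using hex
    refine ⟨r, hr, fun p => ⟨?_, fun w hw => ?_⟩⟩
    · have h1 := hi.section_eq p
      rw [hr p, tangentMap_fibreIncl] at h1
      exact fibreIncl_injective (E := B) (pr p.1) h1
    · obtain ⟨Y, hY, hYw⟩ := exists_isVerticalVF pr p.1 (hsurj p.1) w hw
      have h1 := hi.critical Y hY p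
      rw [hr p, hF.act_vLift, hYw] at h1
      exact h1
  · rintro ⟨r, hr, hc⟩
    refine ⟨fun p => by rw [hr p]; rfl, fun p => ?_, fun Y hY p => ?_⟩
    · rw [hr p, tangentMap_fibreIncl, (hc p).1]
      rfl
    · rw [hr p, hF.act_vLift]
      exact (hc p).2 _ (hY.2 p.1)

/-- Near a point of the slit pullback bundle the fibre part of the induced splitting is the
critical point that the implicit function theorem provides. -/
theorem IsFinsler.contMDiffAt_induced [FiniteDimensional ℝ E] [FiniteDimensional ℝ B]
    (hF : IsFinsler F) (hsurj : ∀ m, Function.Surjective (baseDeriv pr m))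
    {h : PullTN pr → TangentBundle 𝓘(ℝ, E) M} {r : PullTN pr → E}
    (hr : ∀ p, h p = fibreIncl p.1 (r p))
    (hc : ∀ p : PullTN pr, IsCriticalLift pr F p.1 p.2 (r p)) {p₀ : PullTN pr}
    (hp₀ : p₀ ∈ slitPull pr) :
    ContMDiffAt (𝓘(ℝ, E).prod 𝓘(ℝ, B)) 𝓘(ℝ, E).tangent ∞ h p₀ := by
  set m₀ := p₀.1 with hm₀
  have hm₀s := mem_chart_source E m₀
  have hv₀ : (p₀.2 : B) ≠ 0 := hp₀
  have hu₀ : r p₀ ≠ 0 := fun h0 => hv₀ <| by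
    exact (hc p₀).1.symm.trans (h0 ▸ map_zero _)
  have hA₀ : locDeriv pr m₀ (extChartAt 𝓘(ℝ, E) m₀ m₀) = baseDeriv pr m₀ :=
    ContinuousLinearMap.ext locDeriv_self
  obtain ⟨g, hg, hgc⟩ := exists_contDiffAt_critical (hF.contDiffAt_locEnergy hm₀s hu₀)
    (contDiffAt_locDeriv (mem_adaptedNhd_self pr m₀)) (hA₀ ▸ hsurj m₀)
    (fun w hw => by
      rw [hF.hessian_locEnergy m₀ hu₀]
      exact (hF.isMinkowskiEnergy m₀).hessian_pos hu₀ hw)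
    (fun w hw => by
      have h1 := (hc p₀).2 w (hA₀ ▸ hw)
      rw [← hm₀, hF.fderiv_fibreEnergy hm₀s hu₀] at h1
      simpa only [fibreTriv_self] using h1)
  let c : PullTN pr → E × B := fun p =>
    (extChartAt 𝓘(ℝ, E) m₀ p.1, fibreTriv (pr m₀) (pr p.1) p.2)
  have hcp₀ : c p₀ = (extChartAt 𝓘(ℝ, E) m₀ m₀,
      locDeriv pr m₀ (extChartAt 𝓘(ℝ, E) m₀ m₀) (r p₀)) := by
    rw [hA₀, (hc p₀).1]
    exact Prod.ext rfl (fibreTriv_self (E := B) (pr m₀) p₀.2)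
  have hproj : ContMDiffAt (𝓘(ℝ, E).prod 𝓘(ℝ, B)) 𝓘(ℝ, E) ∞ (fun p : PullTN pr => p.1) p₀ :=
    contMDiffAt_proj _
  have hcs : ContMDiffAt (𝓘(ℝ, E).prod 𝓘(ℝ, B)) 𝓘(ℝ, E × B) ∞ c p₀ :=
    (contMDiffAt_extChartAt.comp p₀ hproj).prodMk_space (contMDiffAt_pull_fibreTriv p₀)
  rw [← hcp₀] at hg hgc
  have hgs : ContMDiffAt (𝓘(ℝ, E).prod 𝓘(ℝ, B)) 𝓘(ℝ, E) ∞ (fun p => g (c p)) p₀ :=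
    hg.contMDiffAt.comp p₀ hcs
  have hne : ∀ᶠ p in nhds p₀, (c p).2 ≠ 0 := by
    refine (continuous_snd.continuousAt.comp hcs.continuousAt).eventually_ne ?_
    change (fibreTriv (E := B) (pr m₀) (pr m₀) p₀.2 : B) ≠ 0
    exact fun h0 => hv₀ ((fibreTriv_self (E := B) (pr m₀) p₀.2).symm.trans h0)
  have hnear : ∀ᶠ p : PullTN pr in nhds p₀, p.1 ∈ adaptedNhd pr m₀ :=
    hproj.continuousAt.eventually
      ((isOpen_adaptedNhd pr m₀).mem_nhds (mem_adaptedNhd_self pr m₀))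
  have key : ∀ᶠ p in nhds p₀, fibreTriv m₀ p.1 (r p) = g (c p) := by
    filter_upwards [hne, hnear, hcs.continuousAt.eventually hgc] with p h1 h2 ⟨h3, h4⟩
    let u := fibreTrivSymm m₀ p.1 (g (c p))
    have hu : fibreTriv m₀ p.1 u = g (c p) := fibreTriv_fibreTrivSymm h2.1 _
    have hu0 : u ≠ 0 := fun h0 => h1 <| by
      rw [← h3, ← hu, h0, map_zero, map_zero]
    have hcrit : IsCriticalLift pr F p.1 p.2 u := by
      refine ⟨?_, fun w hw => ?_⟩
      · have h5 := locDeriv_coord h2 u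
        rw [hu] at h5
        have h6 := congrArg (fibreTrivSymm (pr m₀) (pr p.1)) (h5.symm.trans h3)
        rw [fibreTrivSymm_fibreTriv h2.2] at h6
        exact h6.trans (fibreTrivSymm_fibreTriv (E := B) h2.2 p.2)
      · rw [hF.fderiv_fibreEnergy h2.1 hu0, hu]
        refine h4 _ ?_
        have h5 := locDeriv_coord h2 w
        rwa [hw, map_zero] at h5
    rw [hF.isCriticalLift_unique (hc p) hcrit, hu]
  refine Bundle.contMDiffAt_totalSpace.2 ⟨?_, ?_⟩
  · refine hproj.congr_of_eventuallyEq (Filter.Eventually.of_forall fun p => ?_)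
    exact congrArg TotalSpace.proj (hr p)
  · refine hgs.congr_of_eventuallyEq ?_
    filter_upwards [hnear, key] with p h1 h2
    rw [hr p, hr p₀, ← h2]
    exact (fibreTriv_apply h1.1 (r p)).symm

end InducedSplitting

/-! ### The tangent space of the image of the splitting -/

section Tangency

variable {E : Type*} [NormedAddCommGroup E] [NormedSpace ℝ E]
  {M : Type*} [TopologicalSpace M] [ChartedSpace E M]
  {B : Type*} [NormedAddCommGroup B] [NormedSpace ℝ B]
  {N : Type*} [TopologicalSpace N] [ChartedSpace B N] [IsManifold 𝓘(ℝ, B) ∞ N]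
  {pr : C^∞⟮𝓘(ℝ, E), M; 𝓘(ℝ, B), N⟯}

/-- The inclusion of the fibre at `m` into the pullback bundle. -/
def pullIncl (pr : C^∞⟮𝓘(ℝ, E), M; 𝓘(ℝ, B), N⟯) (m : M) (v : B) : PullTN pr := ⟨m, v⟩

theorem trivializationAt_pullIncl_self (m : M) (v : B) :
    (trivializationAt B ((pr : M → N) *ᵖ (TangentSpace 𝓘(ℝ, B) : N → Type _)) m
      (pullIncl pr m v)).2 = v :=
  trivializationAt_fibreIncl_self (pr m) v

theorem hasMFDerivAt_pullIncl (m : M) (v : B) :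
    HasMFDerivAt 𝓘(ℝ, B) (𝓘(ℝ, E).prod 𝓘(ℝ, B)) (pullIncl pr m) v
      (ContinuousLinearMap.inr ℝ E B) := by
  have hc : ContMDiff 𝓘(ℝ, B) (𝓘(ℝ, E).prod 𝓘(ℝ, B)) ∞ (pullIncl pr m) := fun w =>
    Bundle.contMDiffAt_totalSpace.2 ⟨contMDiffAt_const, contMDiffAt_id.congr_of_eventuallyEq
      (Filter.Eventually.of_forall fun w' => trivializationAt_pullIncl_self m w')⟩
  refine ⟨hc.continuous.continuousAt, ?_⟩
  have : HasFDerivAt (fun w : B => (extChartAt 𝓘(ℝ, E) m m, w))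
      (ContinuousLinearMap.inr ℝ E B) v :=
    (hasFDerivAt_const _ _).prodMk (hasFDerivAt_id v)
  refine this.hasFDerivWithinAt.congr (fun w _ => ?_) ?_
  all_goals exact Prod.ext rfl (trivializationAt_pullIncl_self m _)

variable [IsManifold 𝓘(ℝ, E) ∞ M]

/-- The map `(τ, Tπ) : TM → π*TN`, of which nonlinear splittings are right inverses. -/
def toPull (pr : C^∞⟮𝓘(ℝ, E), M; 𝓘(ℝ, B), N⟯) (u : TangentBundle 𝓘(ℝ, E) M) : PullTN pr :=
  pullIncl pr u.1 (baseDeriv pr u.1 u.2)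

theorem contMDiff_toPull :
    ContMDiff 𝓘(ℝ, E).tangent (𝓘(ℝ, E).prod 𝓘(ℝ, B)) ∞ (toPull pr) := fun u => by
  have h1 : ContMDiff 𝓘(ℝ, E).tangent 𝓘(ℝ, B).tangent ∞ (tangentMap 𝓘(ℝ, E) 𝓘(ℝ, B) pr) :=
    pr.contMDiff.contMDiff_tangentMap le_rfl
  exact Bundle.contMDiffAt_totalSpace.2 ⟨contMDiffAt_proj (TangentSpace 𝓘(ℝ, E)),
    (Bundle.contMDiffAt_totalSpace.1 (h1 u)).2⟩

/-- The kernel of the derivative of `(τ, Tπ)` consists of the vertical lifts of `π`-vertical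
vectors. -/
theorem exists_of_mfderiv_toPull_eq_zero (u : TangentBundle 𝓘(ℝ, E) M) (z : E × E)
    (hz : mfderiv 𝓘(ℝ, E).tangent (𝓘(ℝ, E).prod 𝓘(ℝ, B)) (toPull pr) u z = (0 : E × B)) :
    ∃ w : E, z = (0, w) ∧ baseDeriv pr u.1 w = 0 := by
  let D : E × E →L[ℝ] E × B := mfderiv 𝓘(ℝ, E).tangent (𝓘(ℝ, E).prod 𝓘(ℝ, B)) (toPull pr) u
  have hD : HasMFDerivAt 𝓘(ℝ, E).tangent (𝓘(ℝ, E).prod 𝓘(ℝ, B)) (toPull pr) u D :=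
    (contMDiff_toPull.mdifferentiable (by simp) u).hasMFDerivAt
  have hz1 : z.1 = 0 := by
    let Q : E × B →L[ℝ] E := mfderiv (𝓘(ℝ, E).prod 𝓘(ℝ, B)) 𝓘(ℝ, E)
      (TotalSpace.proj : PullTN pr → M) (toPull pr u)
    have hQ : HasMFDerivAt (𝓘(ℝ, E).prod 𝓘(ℝ, B)) 𝓘(ℝ, E) (TotalSpace.proj : PullTN pr → M)
        (toPull pr u) Q :=
      ((contMDiff_proj ((pr : M → N) *ᵖ (TangentSpace 𝓘(ℝ, B) : N → Type _))
        (n := ∞)).mdifferentiable (by simp) _).hasMFDerivAt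
    have h1 := hasMFDerivAt_unique (hQ.comp u hD) (hasMFDerivAt_tangentBundle_proj u)
    have h2 : Q (D z) = z.1 := congrArg (fun L : E × E →L[ℝ] E => L z) h1
    have h3 : D z = 0 := hz
    rw [← h2, h3, map_zero]
  refine ⟨z.2, Prod.ext hz1 rfl, ?_⟩
  let x : E := u.2
  let A : E →L[ℝ] B := baseDeriv pr u.1
  have hp : HasMFDerivAt 𝓘(ℝ, B) (𝓘(ℝ, E).prod 𝓘(ℝ, B)) (pullIncl pr u.1) (A x)
      (ContinuousLinearMap.inr ℝ E B) := hasMFDerivAt_pullIncl u.1 (A x)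
  have hb : HasMFDerivAt 𝓘(ℝ, E) 𝓘(ℝ, B) A x A := A.hasFDerivAt.hasMFDerivAt
  have h1 : HasMFDerivAt 𝓘(ℝ, E) (𝓘(ℝ, E).prod 𝓘(ℝ, B)) (toPull pr ∘ fibreIncl u.1) x
      (D.comp (ContinuousLinearMap.inr ℝ E E)) :=
    HasMFDerivAt.comp x hD (hasMFDerivAt_fibreIncl u.1 x)
  have h2 : HasMFDerivAt 𝓘(ℝ, E) (𝓘(ℝ, E).prod 𝓘(ℝ, B)) (pullIncl pr u.1 ∘ A) x
      ((ContinuousLinearMap.inr ℝ E B).comp A) :=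
    HasMFDerivAt.comp x hp hb
  have h3 : D ((0, z.2) : E × E) = ((0, baseDeriv pr u.1 z.2) : E × B) :=
    congrArg (fun L : E →L[ℝ] E × B => L z.2) (hasMFDerivAt_unique h1 h2)
  have h4 : D ((0, z.2) : E × E) = 0 := by
    rw [← hz1]
    exact hz
  exact congrArg Prod.snd (h3.symm.trans h4)

/-- The Liouville field is tangent to the image of a homogeneous map `h`: it is the velocity of the
curve `t ↦ h(m, t v) = t h(m, v)` at `t = 1`. -/
theorem IsHomogeneous.mfderiv_eq_liouville {h : PullTN pr → TangentBundle 𝓘(ℝ, E) M}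
    (hh : IsHomogeneous pr h) {p : PullTN pr}
    (hd : MDifferentiableAt (𝓘(ℝ, E).prod 𝓘(ℝ, B)) 𝓘(ℝ, E).tangent h p) :
    mfderiv (𝓘(ℝ, E).prod 𝓘(ℝ, B)) 𝓘(ℝ, E).tangent h p ((0, p.2) : E × B) = liouville (h p) := by
  let D : E × B →L[ℝ] E × E := mfderiv (𝓘(ℝ, E).prod 𝓘(ℝ, B)) 𝓘(ℝ, E).tangent h p
  have hD : HasMFDerivAt (𝓘(ℝ, E).prod 𝓘(ℝ, B)) 𝓘(ℝ, E).tangent h p D := hd.hasMFDerivAt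
  let v : B := p.2
  let u : E := (h p).2
  have hv : HasFDerivAt (fun t : ℝ => t • v) ((1 : ℝ →L[ℝ] ℝ).smulRight v) 1 :=
    ((1 : ℝ →L[ℝ] ℝ).smulRight v).hasFDerivAt
  have hu : HasFDerivAt (fun t : ℝ => t • u) ((1 : ℝ →L[ℝ] ℝ).smulRight u) 1 :=
    ((1 : ℝ →L[ℝ] ℝ).smulRight u).hasFDerivAt
  have h1 : HasMFDerivAt 𝓘(ℝ, ℝ) (𝓘(ℝ, E).prod 𝓘(ℝ, B)) (fun t : ℝ => pullIncl pr p.1 (t • v)) 1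
      ((ContinuousLinearMap.inr ℝ E B).comp ((1 : ℝ →L[ℝ] ℝ).smulRight v)) :=
    HasMFDerivAt.comp (1 : ℝ) (hasMFDerivAt_pullIncl p.1 ((1 : ℝ) • v)) hv.hasMFDerivAt
  have h2 : HasMFDerivAt 𝓘(ℝ, ℝ) 𝓘(ℝ, E).tangent (fun t : ℝ => fibreIncl (h p).1 (t • u)) 1
      ((ContinuousLinearMap.inr ℝ E E).comp ((1 : ℝ →L[ℝ] ℝ).smulRight u)) :=
    HasMFDerivAt.comp (1 : ℝ) (hasMFDerivAt_fibreIncl (h p).1 ((1 : ℝ) • u)) hu.hasMFDerivAt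
  have hp : pullIncl pr p.1 ((1 : ℝ) • v) = p := by
    rw [one_smul]
    rfl
  have hD' : HasMFDerivAt (𝓘(ℝ, E).prod 𝓘(ℝ, B)) 𝓘(ℝ, E).tangent h
      (pullIncl pr p.1 ((1 : ℝ) • v)) D := by
    rw [hp]
    exact hD
  have h3 : HasMFDerivAt 𝓘(ℝ, ℝ) 𝓘(ℝ, E).tangent (h ∘ fun t : ℝ => pullIncl pr p.1 (t • v)) 1
      (D.comp ((ContinuousLinearMap.inr ℝ E B).comp ((1 : ℝ →L[ℝ] ℝ).smulRight v))) :=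
    HasMFDerivAt.comp (1 : ℝ) hD' h1
  have h4 : (fun t : ℝ => fibreIncl (h p).1 (t • u)) =ᶠ[nhds 1]
      (h ∘ fun t : ℝ => pullIncl pr p.1 (t • v)) := by
    filter_upwards [Ioi_mem_nhds (zero_lt_one (α := ℝ))] with t ht
    exact (hh t ht p).symm
  have h5 := hasMFDerivAt_unique (h3.congr_of_eventuallyEq h4) h2
  have h6 : D ((0, (1 : ℝ) • v) : E × B) = ((0, (1 : ℝ) • u) : E × E) :=
    congrArg (fun L : ℝ →L[ℝ] E × E => L 1) h5
  rw [one_smul, one_smul] at h6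
  rw [liouville_eq]
  exact h6

/-- The tangent space of the image of the induced splitting is cut out by the differentials of the
functions `Yᵛ(E)`. They vanish on the image, which gives one inclusion. Conversely a vector `V` in
their common kernel differs from the image under `Th` of its projection to `π*TN` by the vertical
lift of a `π`-vertical vector `w`; for a vertical field `Y` through `w`, the derivative of `Yᵛ(E)`
along that lift is the value of the Hessian of the energy on `(w, w)`, so `w = 0`. -/
theorem IsFinsler.mem_range_mfderiv_iff [FiniteDimensional ℝ E] [FiniteDimensional ℝ B] [T2Space M]
    {F : TangentBundle 𝓘(ℝ, E) M → ℝ} (hF : IsFinsler F)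
    (hsurj : ∀ m, Function.Surjective (baseDeriv pr m))
    {h : PullTN pr → TangentBundle 𝓘(ℝ, E) M} (hi : IsInduced pr F h) {p : PullTN pr}
    (hu : h p ∈ slit E M)
    (hd : MDifferentiableAt (𝓘(ℝ, E).prod 𝓘(ℝ, B)) 𝓘(ℝ, E).tangent h p)
    (V : TangentSpace 𝓘(ℝ, E).tangent (h p)) :
    (∃ ξ : TangentSpace (𝓘(ℝ, E).prod 𝓘(ℝ, B)) p,
      mfderiv (𝓘(ℝ, E).prod 𝓘(ℝ, B)) 𝓘(ℝ, E).tangent h p ξ = V) ↔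
    ∀ Y : (m : M) → TangentSpace 𝓘(ℝ, E) m, IsVerticalVF pr Y →
      mfderiv 𝓘(ℝ, E).tangent 𝓘(ℝ, ℝ) (act (vLift Y) (energy F)) (h p) V = (0 : ℝ) := by
  let D : E × B →L[ℝ] E × E := mfderiv (𝓘(ℝ, E).prod 𝓘(ℝ, B)) 𝓘(ℝ, E).tangent h p
  have hD : HasMFDerivAt (𝓘(ℝ, E).prod 𝓘(ℝ, B)) 𝓘(ℝ, E).tangent h p D := hd.hasMFDerivAt
  have hvan : ∀ Y : (m : M) → TangentSpace 𝓘(ℝ, E) m, IsVerticalVF pr Y → ∀ ξ : E × B,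
      mfderiv 𝓘(ℝ, E).tangent 𝓘(ℝ, ℝ) (act (vLift Y) (energy F)) (h p) (D ξ) = (0 : ℝ) := by
    intro Y hY ξ
    let L : E × E →L[ℝ] ℝ := mfderiv 𝓘(ℝ, E).tangent 𝓘(ℝ, ℝ) (act (vLift Y) (energy F)) (h p)
    have hL : HasMFDerivAt 𝓘(ℝ, E).tangent 𝓘(ℝ, ℝ) (act (vLift Y) (energy F)) (h p) L :=
      ((hF.contMDiffAt_act_vLift hY.1 hu).mdifferentiableAt (by simp)).hasMFDerivAt
    have h1 : act (vLift Y) (energy F) ∘ h = fun _ => 0 := funext fun q => hi.critical Y hY q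
    have h2 := HasMFDerivAt.comp p hL hD
    rw [h1] at h2
    exact congrArg (fun L : E × B →L[ℝ] ℝ => L ξ)
      (hasMFDerivAt_unique h2 (hasMFDerivAt_const (0 : ℝ) p))
  constructor
  · rintro ⟨ξ, rfl⟩ Y hY
    exact hvan Y hY ξ
  · intro hV
    let K : E × E →L[ℝ] E × B :=
      mfderiv 𝓘(ℝ, E).tangent (𝓘(ℝ, E).prod 𝓘(ℝ, B)) (toPull pr) (h p)
    have hK : HasMFDerivAt 𝓘(ℝ, E).tangent (𝓘(ℝ, E).prod 𝓘(ℝ, B)) (toPull pr) (h p) K :=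
      (contMDiff_toPull.mdifferentiable (by simp) (h p)).hasMFDerivAt
    obtain ⟨r, hr, hc⟩ := (hF.isInduced_iff hsurj).1 hi
    have hid : toPull pr ∘ h = id := funext fun q => by
      change toPull pr (h q) = q
      rw [hr q]
      change pullIncl pr q.1 (baseDeriv pr q.1 (r q)) = q
      rw [(hc q).1]
      rfl
    have hKD : ∀ ξ, K (D ξ) = ξ := fun ξ => by
      have h1 := HasMFDerivAt.comp p hK hD
      rw [hid] at h1
      exact congrArg (fun L : E × B →L[ℝ] E × B => L ξ) (hasMFDerivAt_unique h1 (hasMFDerivAt_id p))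
    let V' : E × E := V
    obtain ⟨w, hw, hw0⟩ := exists_of_mfderiv_toPull_eq_zero (pr := pr) (h p) (V' - D (K V'))
      (by
        change K (V' - D (K V')) = 0
        rw [map_sub, hKD, sub_self])
    refine ⟨K V', ?_⟩
    change D (K V') = V'
    suffices hw' : w = 0 by
      rw [hw', Prod.mk_zero_zero, sub_eq_zero] at hw
      exact hw.symm
    by_contra hne
    obtain ⟨Y, hY, hYw⟩ := exists_isVerticalVF pr (h p).1 (hsurj _) w hw0
    have hpos := (hF.isMinkowskiEnergy (h p).1).hessian_pos hu hne
    have h1 := hF.mfderiv_act_vLift hY.1 (h p).1 hu w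
    rw [hYw] at h1
    let L : E × E →L[ℝ] ℝ := mfderiv 𝓘(ℝ, E).tangent 𝓘(ℝ, ℝ) (act (vLift Y) (energy F)) (h p)
    have h2 : L (V' - D (K V')) = 0 := by
      rw [map_sub, sub_eq_zero]
      exact (hV Y hY).trans (hvan Y hY (K V')).symm
    rw [hw] at h2
    exact hpos.ne' (h1.symm.trans h2)

end Tangency

/-! ### Tangency of sprays -/

section Conclusion

variable {E : Type*} [NormedAddCommGroup E] [NormedSpace ℝ E] [FiniteDimensional ℝ E]
  {M : Type*} [TopologicalSpace M] [ChartedSpace E M] [IsManifold 𝓘(ℝ, E) ∞ M] [T2Space M]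
  {B : Type*} [NormedAddCommGroup B] [NormedSpace ℝ B] [FiniteDimensional ℝ B]
  {N : Type*} [TopologicalSpace N] [ChartedSpace B N] [IsManifold 𝓘(ℝ, B) ∞ N]
  {pr : C^∞⟮𝓘(ℝ, E), M; 𝓘(ℝ, B), N⟯} {F : TangentBundle 𝓘(ℝ, E) M → ℝ}

theorem IsFinsler.existsUnique_isInduced (hF : IsFinsler F)
    (hsurj : ∀ m, Function.Surjective (baseDeriv pr m)) :
    ∃! h : PullTN pr → TangentBundle 𝓘(ℝ, E) M, IsInduced pr F h := by
  choose r₀ hr₀ using fun p : PullTN pr =>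
    hF.exists_isCriticalLift (pr := pr) (hsurj p.1) (p.2 : B)
  refine ⟨fun p => fibreIncl p.1 (r₀ p),
    (hF.isInduced_iff hsurj).2 ⟨r₀, fun _ => rfl, hr₀⟩, fun h hi => ?_⟩
  obtain ⟨r, hr, hc⟩ := (hF.isInduced_iff hsurj).1 hi
  funext p
  rw [hr p, hF.isCriticalLift_unique (hc p) (hr₀ p)]

variable {h : PullTN pr → TangentBundle 𝓘(ℝ, E) M}

theorem IsFinsler.isNonlinearSplitting (hF : IsFinsler F)
    (hsurj : ∀ m, Function.Surjective (baseDeriv pr m)) (hi : IsInduced pr F h) :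
    IsNonlinearSplitting pr h := by
  obtain ⟨r, hr, hc⟩ := (hF.isInduced_iff hsurj).1 hi
  exact ⟨fun p hp => (hF.contMDiffAt_induced hsurj hr hc hp).contMDiffWithinAt,
    hi.fibre_preserving, hi.section_eq⟩

theorem IsFinsler.isHomogeneous (hF : IsFinsler F)
    (hsurj : ∀ m, Function.Surjective (baseDeriv pr m)) (hi : IsInduced pr F h) :
    IsHomogeneous pr h := by
  obtain ⟨r, hr, hc⟩ := (hF.isInduced_iff hsurj).1 hi
  exact hF.isHomogeneous_induced hr hc

theorem IsFinsler.mdifferentiableAt_induced (hF : IsFinsler F)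
    (hsurj : ∀ m, Function.Surjective (baseDeriv pr m)) (hi : IsInduced pr F h) {p : PullTN pr}
    (hp : p ∈ slitPull pr) :
    MDifferentiableAt (𝓘(ℝ, E).prod 𝓘(ℝ, B)) 𝓘(ℝ, E).tangent h p := by
  obtain ⟨r, hr, hc⟩ := (hF.isInduced_iff hsurj).1 hi
  exact (hF.contMDiffAt_induced hsurj hr hc hp).mdifferentiableAt (by simp)

theorem IsFinsler.induced_mem_slit (hF : IsFinsler F)
    (hsurj : ∀ m, Function.Surjective (baseDeriv pr m)) (hi : IsInduced pr F h) {p : PullTN pr}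
    (hp : p ∈ slitPull pr) : h p ∈ slit E M := by
  obtain ⟨r, hr, hc⟩ := (hF.isInduced_iff hsurj).1 hi
  have hne : r p ≠ 0 := fun h0 => hp ((hc p).1.symm.trans (h0 ▸ map_zero (baseDeriv pr p.1)))
  rw [hr p]
  exact hne

/-- Over zero vectors the induced splitting takes its values in the zero section, where all
derivatives of the energy vanish. -/
theorem IsFinsler.act_energy_induced_of_notMem_slitPull (hF : IsFinsler F)
    (hsurj : ∀ m, Function.Surjective (baseDeriv pr m)) (hi : IsInduced pr F h) {p : PullTN pr}
    (hp : p ∉ slitPull pr)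
    (V : (u : TangentBundle 𝓘(ℝ, E) M) → TangentSpace 𝓘(ℝ, E).tangent u) :
    act V (energy F) (h p) = 0 := by
  obtain ⟨r, hr, hc⟩ := (hF.isInduced_iff hsurj).1 hi
  have hv : (p.2 : B) = 0 := not_not.1 hp
  have h0 : IsCriticalLift pr F p.1 p.2 (0 : E) := by
    refine ⟨(map_zero (baseDeriv pr p.1)).trans hv.symm, fun w _ => ?_⟩
    rw [(hF.isMinkowskiEnergy p.1).fderiv_zero]
    rfl
  rw [hr p, hF.isCriticalLift_unique (hc p) h0]
  exact hF.mfderiv_energy_zero p.1 _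

/-- On the image of the induced splitting `S(Yᵛ(E)) = Yᶜ(E)`, and `S` is tangent to the image if
and only if the left-hand sides vanish. -/
theorem IsFinsler.isTangentToIm_iff (hF : IsFinsler F)
    (hsurj : ∀ m, Function.Surjective (baseDeriv pr m)) (hi : IsInduced pr F h)
    {S : (u : TangentBundle 𝓘(ℝ, E) M) → TangentSpace 𝓘(ℝ, E).tangent u}
    (hS : IsCanonicalSpray F S) :
    IsTangentToIm pr h S ↔ ∀ Y : (m : M) → TangentSpace 𝓘(ℝ, E) m, IsVerticalVF pr Y →
      ∀ p, act (cLift Y) (energy F) (h p) = 0 := by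
  have key : ∀ p ∈ slitPull pr, _ := fun p hp =>
    hF.mem_range_mfderiv_iff hsurj hi (hF.induced_mem_slit hsurj hi hp)
      (hF.mdifferentiableAt_induced hsurj hi hp) (S (h p))
  refine ⟨fun ht Y hY p => ?_, fun hc p hp => (key p hp).2 fun Y hY => ?_⟩
  · by_cases hp : p ∈ slitPull pr
    · have h1 : act S (act (vLift Y) (energy F)) (h p) = 0 := (key p hp).1 (ht p hp) Y hY
      have h2 := hS.eulerLagrange Y hY.1 (h p) (hF.induced_mem_slit hsurj hi hp)
      linarith
    · exact hF.act_energy_induced_of_notMem_slitPull hsurj hi hp _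
  · have h1 := hS.eulerLagrange Y hY.1 (h p) (hF.induced_mem_slit hsurj hi hp)
    rw [hc Y hY p, sub_zero] at h1
    exact h1

/-- Projectively related sprays differ by a multiple of the Liouville field, which is tangent to
the image. -/
theorem IsFinsler.isTangentToIm_of_projRelated (hF : IsFinsler F)
    (hsurj : ∀ m, Function.Surjective (baseDeriv pr m)) (hi : IsInduced pr F h)
    {S S' : (u : TangentBundle 𝓘(ℝ, E) M) → TangentSpace 𝓘(ℝ, E).tangent u}
    (ht : IsTangentToIm pr h S) (hSS' : ProjRelated S S') : IsTangentToIm pr h S' := fun p hp => by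
  obtain ⟨Q, -, hQ⟩ := hSS'
  obtain ⟨ξ, hξ⟩ := ht p hp
  let η : TangentSpace (𝓘(ℝ, E).prod 𝓘(ℝ, B)) p := ((0, p.2) : E × B)
  have hη : mfderiv (𝓘(ℝ, E).prod 𝓘(ℝ, B)) 𝓘(ℝ, E).tangent h p η = liouville (h p) :=
    (hF.isHomogeneous hsurj hi).mfderiv_eq_liouville (hF.mdifferentiableAt_induced hsurj hi hp)
  refine ⟨ξ - (2 * Q (h p)) • η, ?_⟩
  rw [hQ (h p) (hF.induced_mem_slit hsurj hi hp), ← hξ, ← hη, map_sub, map_smul]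

end Conclusion

end FinslerSplitting

end

theorem mainTheorem1
    {E : Type*} [NormedAddCommGroup E] [NormedSpace ℝ E] [FiniteDimensional ℝ E]
    {M : Type*} [TopologicalSpace M] [ChartedSpace E M] [IsManifold 𝓘(ℝ, E) ∞ M] [T2Space M]
    {B : Type*} [NormedAddCommGroup B] [NormedSpace ℝ B] [FiniteDimensional ℝ B]
    {N : Type*} [TopologicalSpace N] [ChartedSpace B N] [IsManifold 𝓘(ℝ, B) ∞ N] [T2Space N]
    {C : Type*} [NormedAddCommGroup C] [NormedSpace ℝ C] [FiniteDimensional ℝ C]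
    {P : Type*} [TopologicalSpace P] [ChartedSpace C P] [IsManifold 𝓘(ℝ, C) ∞ P] [T2Space P]
    (pr : C^∞⟮𝓘(ℝ, E), M; 𝓘(ℝ, B), N⟯) (hpr : FinslerSplitting.IsFibreBundle C P pr)
    (F : TangentBundle 𝓘(ℝ, E) M → ℝ) (hF : FinslerSplitting.IsFinsler F) :
    (∃! h : FinslerSplitting.PullTN pr → TangentBundle 𝓘(ℝ, E) M,
      FinslerSplitting.IsInduced pr F h) ∧
    ∀ h : FinslerSplitting.PullTN pr → TangentBundle 𝓘(ℝ, E) M, FinslerSplitting.IsInduced pr F h →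
      (FinslerSplitting.IsNonlinearSplitting pr h ∧ FinslerSplitting.IsHomogeneous pr h) ∧
      ∀ S : (u : TangentBundle 𝓘(ℝ, E) M) → TangentSpace 𝓘(ℝ, E).tangent u,
        FinslerSplitting.IsCanonicalSpray F S →
        (FinslerSplitting.IsTangentToIm pr h S ↔
          ∀ Y : (m : M) → TangentSpace 𝓘(ℝ, E) m, FinslerSplitting.IsVerticalVF pr Y →
            ∀ p, FinslerSplitting.act (FinslerSplitting.cLift Y)
              (FinslerSplitting.energy F) (h p) = 0) ∧
        (FinslerSplitting.IsTangentToIm pr h S →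
          ∀ S' : (u : TangentBundle 𝓘(ℝ, E) M) → TangentSpace 𝓘(ℝ, E).tangent u,
            FinslerSplitting.IsSpray S' → FinslerSplitting.ProjRelated S S' →
            FinslerSplitting.IsTangentToIm pr h S') := by
  have hsurj := hpr.surjective_baseDeriv
  exact ⟨hF.existsUnique_isInduced hsurj, fun h hi =>
    ⟨⟨hF.isNonlinearSplitting hsurj hi, hF.isHomogeneous hsurj hi⟩, fun S hS =>
      ⟨hF.isTangentToIm_iff hsurj hi hS, fun ht S' _ hSS' =>
        hF.isTangentToIm_of_projRelated hsurj hi ht hSS'⟩⟩⟩
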